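/- **Setting and conventions.** Let $M,e,\Lambda\in\mathbb R$ and $f(r)=1-\frac{2M}{r}+\frac{e^2}{r^2}-\Lambda r^2$. The Reissner–Nordström–de Sitter (RNdS) spacetime is the region $\{r>0,\ f(r)\neq0,\ 0<\theta<\pi\}$ of $\mathbb R^4\ni(t,r,\theta,\phi)=(x^1,x^2,x^3,x^4)$ with the metric $$g=-f(r)\,dt^2+\frac{dr^2}{f(r)}+r^2(d\theta^2+\sin^2\theta\,d\phi^2).$$ With the Christoffel symbols $\Gamma^k_{ij}$ of $g$ and $n=4$, put $$R_{hijk}=g_{h\alpha}\big(\partial_j\Gamma^\alpha_{ik}-\partial_k\Gamma^\alpha_{ij}+\Gamma^\beta_{ik}\Gamma^\alpha_{\beta j}-\Gamma^\beta_{ij}\Gamma^\alpha_{\beta k}\big),\quad Ric_{ij}=g^{hk}R_{hijk},\quad \kappa=g^{ij}Ric_{ij}$$ (with these signs $\kappa=-12\Lambda$). For symmetric $F,H$ let $(F\wedge H)_{ijkl}=F_{il}H_{kj}-F_{ik}H_{lj}+F_{jk}H_{li}-F_{jl}H_{ki}$. The conharmonic, concircular, conformal and projective curvature tensors are $$K=R-\tfrac1{n-2}\,g\wedge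 Ric,\qquad W=R-\tfrac{\kappa}{2n(n-1)}\,g\wedge g,$$ $$C=R-\tfrac1{n-2}\,g\wedge Ric+\tfrac{\kappa}{2(n-1)(n-2)}\,g\wedge g,\qquad P_{hijk}=R_{hijk}-\tfrac1{n-1}(g_{hk}Ric_{ij}-g_{ik}Ric_{hj}).$$ For a $(0,4)$ tensor $X$ let $X^\alpha{}_{wsb}=X_{wsbk}g^{k\alpha}$. For a $(0,d)$ tensor $Y$ and a symmetric $(0,2)$ tensor $A$ let $$(X\cdot Y)_{b_1\dots b_d\,ws}=-\sum_{p=1}^d X^\alpha{}_{wsb_p}\,Y_{b_1\dots\alpha\dots b_d},\qquad Q(A,Y)_{b_1\dots b_d\,ws}=\sum_{p=1}^d\big(A_{wb_p}Y_{b_1\dots s\dots b_d}-A_{sb_p}Y_{b_1\dots w\dots b_d}\big),$$ where $\alpha,s,w$ stand in the $p$-th slot. A symmetric $(0,2)$ tensor $Z$, with $\mathcal B$ given by $g(\mathcal BX,Y)=Z(X,Y)$, is called $B$-compatible if the cyclic sum over $Q_1,Q_2,Q_3$ of $B(\mathcal BQ_1,Q,Q_2,Q_3)$ vanishes for all $Q,Q_1,Q_2,Q_3$.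 In this condition the skew pair of $B$ stands last. Accordingly, "$P$-compatible" refers to the tensor $(U,Z',X,Y)\mapsto P(X,Y,Z',U)=g(P(X,Y)Z',U)$. (For $R,C,W,K$ the same reordering only changes the overall sign.) Put $L_R=-\frac{e^2-Mr+\Lambda r^4}{r^4}$, $L_C=-\frac{e^2-Mr}{r^4}$, $L_K=-\frac{e^2-Mr-2\Lambda r^4}{r^4}$ and $N=2e^4-6e^2Mr+3M^2r^2-6\Lambda e^2r^4+6M\Lambda r^5$. **Theorem.** The RNdS spacetime has the following properties. 1. $R\cdot Y=L_R\,Q(g,Y)$ for $Y=R,C,P,W,K$. 2. $C\cdot Y=L_C\,Q(g,Y)$ for $Y=R,C,P,W,K$. 3. $R\cdot Ric=L_R\,Q(g,Ric)$, $C\cdot Ric=L_C\,Q(g,Ric)$, $P\cdot Ric=L_R\,Q(g,Ric)$, $W\cdot Ric=L_C\,Q(g,Ric)$, $K\cdot Ric=L_K\,Q(g,Ric)$. 4. $W\cdot Y=L_C\,Q(g,Y)$ for $Y=R,C,P,W,K$. 5. $K\cdot Y=L_K\,Q(g,Y)$ for $Y=R,C,P,W,K$. 6. Wherever $Mr\neq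 e^2$, $\;R\cdot R-Q(Ric,R)=\mathcal L_1\,Q(g,C)$ with $\mathcal L_1=\dfrac{N}{3r^4(Mr-e^2)}$. 7. $C\cdot R-R\cdot C$ is a linear combination of $Q(g,C),Q(Ric,C),Q(g,R),Q(Ric,R)$; explicitly, everywhere $$C\cdot R-R\cdot C=4\Lambda\,Q(g,C)+Q(Ric,C),$$ and, wherever $N\neq0$, $$C\cdot R-R\cdot C=\frac{Mr-e^2}{r^4}\Big(1-\frac{3(\Lambda r^4-Mr+e^2)^2}{N}\Big)Q(g,R)-\frac{3(Mr-e^2)(\Lambda r^4-Mr+e^2)}{N}\,Q(Ric,R).$$ 8. If $e\neq0$, it is 2-quasi-Einstein: $Ric-Lg$ has rank $2$ at every point for $L=-\frac{3\Lambda r^4-e^2}{r^4}$. 9. It is $\mathrm{Ein}(2)$: $Ric^2+6\Lambda\,Ric+\frac{9\Lambda^2r^8-e^4}{r^8}\,g=0$, where $Ric^2_{ij}=Ric_{i\alpha}g^{\alpha\beta}Ric_{\beta j}$. 10. Suppose $(M,e)\neq(0,0)$. A symmetric $(0,2)$ tensor at a point is compatible with $R$ (respectively $P$, $W$) if and only if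 it has the block form $$\begin{pmatrix}\mathscr Z_{11}&\mathscr Z_{12}&0&0\\ \mathscr Z_{12}&\mathscr Z_{22}&0&0\\ 0&0&\mathscr Z_{33}&\mathscr Z_{34}\\ 0&0&\mathscr Z_{34}&\mathscr Z_{44}\end{pmatrix}$$ with arbitrary $\mathscr Z_{ij}$; the same holds for $C$ and for $K$ at points with $Mr\neq e^2$. Moreover, for each $B\in\{R,C,P,W,K\}$, a continuous symmetric $(0,2)$ tensor field on an open subset of the spacetime is $B$-compatible there if and only if it has this block form there. -/

import Mathlib

/-! Semi-Riemannian geometry in a coordinate chart. Points are coordinate vectors `x : Fin n → ℝ`,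
a metric is a matrix-valued function `g`, and a tensor of type `(0,d)` at a point is the array of
its components. -/

noncomputable section

namespace ChartGeometry

/-- Component arrays of tensors of type `(0,d)` in dimension `n`. -/
abbrev Tensor (n d : ℕ) : Type := (Fin d → Fin n) → ℝ

/-- The metric components `g_{ij}` as functions of the coordinates. -/
abbrev Metric (n : ℕ) : Type := (Fin n → ℝ) → Matrix (Fin n) (Fin n) ℝ

/-- The partial derivative `∂F/∂xⁱ` at `x`. -/
def partialDeriv {n : ℕ} (i : Fin n) (F : (Fin n → ℝ) → ℝ) (x : Fin n → ℝ) : ℝ :=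
  deriv (fun s : ℝ => F (Function.update x i s)) (x i)

/-- Christoffel symbols of the second kind,
`Γ^k_{ij} = ½ g^{kl} (∂_i g_{jl} + ∂_j g_{il} - ∂_l g_{ij})`. -/
def christoffel {n : ℕ} (g : Metric n) (k i j : Fin n) (x : Fin n → ℝ) : ℝ :=
  (1 / 2) * ∑ l, (g x)⁻¹ k l *
    (partialDeriv i (fun y => g y j l) x + partialDeriv j (fun y => g y i l) x
      - partialDeriv l (fun y => g y i j) x)

/-- The metric as a `(0,2)` tensor at `x`. -/
def metricTensor {n : ℕ} (g : Metric n) (x : Fin n → ℝ) : Tensor n 2 :=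
  fun b => g x (b 0) (b 1)

/-- The `(0,4)` curvature tensor
`R_{hijk} = g_{hα} (∂_j Γ^α_{ik} - ∂_k Γ^α_{ij} + Γ^β_{ik} Γ^α_{βj} - Γ^β_{ij} Γ^α_{βk})`.
With this sign `R_{1212} = c g_{11} g_{22}` in an orthogonal chart of constant curvature `c`. -/
def riemann {n : ℕ} (g : Metric n) (x : Fin n → ℝ) : Tensor n 4 :=
  fun b => ∑ α, g x (b 0) α *
    (partialDeriv (b 2) (christoffel g α (b 1) (b 3)) x
      - partialDeriv (b 3) (christoffel g α (b 1) (b 2)) x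
      + ∑ β, (christoffel g β (b 1) (b 3) x * christoffel g α β (b 2) x
          - christoffel g β (b 1) (b 2) x * christoffel g α β (b 3) x))

/-- The Ricci tensor `Ric_{ij} = g^{hk} R_{hijk}`.  With the sign of `riemann` it equals
`-(n - 1) c g` in constant curvature `c`. -/
def ricci {n : ℕ} (g : Metric n) (x : Fin n → ℝ) : Tensor n 2 :=
  fun b => ∑ h, ∑ k, (g x)⁻¹ h k * riemann g x ![h, b 0, b 1, k]

/-- The scalar curvature `κ = g^{ij} Ric_{ij}`. -/
def scalarCurvature {n : ℕ} (g : Metric n) (x : Fin n → ℝ) : ℝ :=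
  ∑ i, ∑ j, (g x)⁻¹ i j * ricci g x ![i, j]

/-- `Ric²_{ij} = Ric_{iα} g^{αβ} Ric_{βj}`. -/
def ricciSq {n : ℕ} (g : Metric n) (x : Fin n → ℝ) : Tensor n 2 :=
  fun b => ∑ α, ∑ β, ricci g x ![b 0, α] * (g x)⁻¹ α β * ricci g x ![β, b 1]

/-- The Kulkarni–Nomizu product
`(F ∧ H)_{ijkl} = F_{il} H_{kj} - F_{ik} H_{lj} + F_{jk} H_{li} - F_{jl} H_{ki}`. -/
def kulkarniNomizu {n : ℕ} (F H : Tensor n 2) : Tensor n 4 :=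
  fun b => F ![b 0, b 3] * H ![b 2, b 1] - F ![b 0, b 2] * H ![b 3, b 1]
    + F ![b 1, b 2] * H ![b 3, b 0] - F ![b 1, b 3] * H ![b 2, b 0]

/-- The conformal (Weyl) curvature tensor `C`. -/
def conformal {n : ℕ} (g : Metric n) (x : Fin n → ℝ) : Tensor n 4 :=
  riemann g x - (1 / ((n : ℝ) - 2)) • kulkarniNomizu (metricTensor g x) (ricci g x)
    + (scalarCurvature g x / (2 * ((n : ℝ) - 1) * ((n : ℝ) - 2))) •
      kulkarniNomizu (metricTensor g x) (metricTensor g x)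

/-- The conharmonic curvature tensor `K`. -/
def conharmonic {n : ℕ} (g : Metric n) (x : Fin n → ℝ) : Tensor n 4 :=
  riemann g x - (1 / ((n : ℝ) - 2)) • kulkarniNomizu (metricTensor g x) (ricci g x)

/-- The concircular curvature tensor `W`. -/
def concircular {n : ℕ} (g : Metric n) (x : Fin n → ℝ) : Tensor n 4 :=
  riemann g x - (scalarCurvature g x / (2 * (n : ℝ) * ((n : ℝ) - 1))) •
    kulkarniNomizu (metricTensor g x) (metricTensor g x)

/-- The projective curvature tensor
`P_{hijk} = R_{hijk} - (1/(n-1)) (g_{hk} Ric_{ij} - g_{ik} Ric_{hj})`;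
it is skew in `h, i`, but in general not in `j, k`. -/
def projective {n : ℕ} (g : Metric n) (x : Fin n → ℝ) : Tensor n 4 :=
  fun b => riemann g x b - (1 / ((n : ℝ) - 1)) *
    (g x (b 0) (b 3) * ricci g x ![b 1, b 2] - g x (b 1) (b 3) * ricci g x ![b 0, b 2])

/-- The `(0,d+2)` tensor `X · Y`, with
`(X·Y)_{b₁…b_d w s} = -(X^α_{w s b₁} Y_{α b₂…b_d} + … + X^α_{w s b_d} Y_{b₁…α})`, where
`X(U,V,Z,T) = g(X(U,V)Z,T)`, that is `X^α_{wsb} = X_{wsbk} g^{kα}`. -/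
def curvAction {n d : ℕ} (g : Metric n) (x : Fin n → ℝ) (X : Tensor n 4) (Y : Tensor n d) :
    (Fin d → Fin n) → Fin n → Fin n → ℝ :=
  fun b w s => -∑ p, ∑ α, (∑ k, X ![w, s, b p, k] * (g x)⁻¹ k α) * Y (Function.update b p α)

/-- The Tachibana tensor `Q(A,Y)`, with
`Q(A,Y)_{b₁…b_d w s} = A_{w b₁} Y_{s b₂…b_d} + … + A_{w b_d} Y_{b₁…s}
  - A_{s b₁} Y_{w b₂…b_d} - … - A_{s b_d} Y_{b₁…w}`. -/
def tachibana {n d : ℕ} (A : Tensor n 2) (Y : Tensor n d) :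
    (Fin d → Fin n) → Fin n → Fin n → ℝ :=
  fun b w s => ∑ p, (A ![w, b p] * Y (Function.update b p s)
    - A ![s, b p] * Y (Function.update b p w))

/-- The components `𝓑^m_a = g^{ml} Z_{la}` of the endomorphism with `g(𝓑U,V) = Z(U,V)`. -/
def endo {n : ℕ} (g : Metric n) (x : Fin n → ℝ) (Z : Matrix (Fin n) (Fin n) ℝ) (m a : Fin n) :
    ℝ :=
  ∑ l, (g x)⁻¹ m l * Z l a

/-- A symmetric `(0,2)` tensor `Z` is `B`-compatible (at `x`) if the cyclic sum over `q₁, q₂, q₃`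
of `B(𝓑 q₁, q, q₂, q₃)` vanishes. -/
def IsCompatible {n : ℕ} (g : Metric n) (x : Fin n → ℝ) (B : Tensor n 4)
    (Z : Matrix (Fin n) (Fin n) ℝ) : Prop :=
  ∀ q q₁ q₂ q₃ : Fin n, ∑ m, (endo g x Z m q₁ * B ![m, q, q₂, q₃]
    + endo g x Z m q₂ * B ![m, q, q₃, q₁] + endo g x Z m q₃ * B ![m, q, q₁, q₂]) = 0

/-- The projective tensor with its slots in the order that `IsCompatible` expects, the skew pair
last: the component `(h,i,j,k)` is `g(P(∂_j,∂_k)∂_i, ∂_h) = P_{jkih}`.  (For `R, C, W, K`, which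
have all the symmetries of a curvature tensor, this reordering only changes the overall sign.) -/
def projectiveSkewLast {n : ℕ} (g : Metric n) (x : Fin n → ℝ) : Tensor n 4 :=
  fun b => projective g x ![b 2, b 3, b 1, b 0]

end ChartGeometry

namespace RNdS

/-- The lapse function `f(r) = 1 - 2M/r + e²/r² - Λ r²`. -/
def lapse (M e Λ r : ℝ) : ℝ := 1 - 2 * M / r + e ^ 2 / r ^ 2 - Λ * r ^ 2

/-- The coordinate domain: `x = (t, r, θ, φ)` with `r > 0`, `f(r) ≠ 0`, `0 < θ < π`. -/
def domain (M e Λ : ℝ) : Set (Fin 4 → ℝ) :=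
  {x | 0 < x 1 ∧ lapse M e Λ (x 1) ≠ 0 ∧ 0 < x 2 ∧ x 2 < Real.pi}

/-- The metric `-f dt² + dr²/f + r² (dθ² + sin²θ dφ²)`. -/
def metric (M e Λ : ℝ) : ChartGeometry.Metric 4 := fun x =>
  Matrix.diagonal ![-lapse M e Λ (x 1), (lapse M e Λ (x 1))⁻¹, (x 1) ^ 2,
    (x 1) ^ 2 * (Real.sin (x 2)) ^ 2]

/-- Block-diagonal form: a `(t,r)` block and a `(θ,φ)` block. -/
def IsBlockDiagonal (Z : Matrix (Fin 4) (Fin 4) ℝ) : Prop :=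
  Z 0 2 = 0 ∧ Z 0 3 = 0 ∧ Z 1 2 = 0 ∧ Z 1 3 = 0 ∧
    Z 2 0 = 0 ∧ Z 3 0 = 0 ∧ Z 2 1 = 0 ∧ Z 3 1 = 0

end RNdS

end

/-! ### Partial derivatives of component functions -/

namespace ChartGeometry

/-! The metric is diagonal and splits into a `(t,r)` block `h` and a `(θ,φ)` block `k`. Its
curvature is diagonal on coordinate planes, with only three sectional curvatures: `a` on the `(t,r)`
plane, `b` on the four mixed planes, `c` on the `(θ,φ)` plane (`riemann_metric`). Hence `Ric` is a
combination of `h` and `k`, the tensors `C, W, K` are again block curvatures, and `P` differs from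
`R` by a product of `g` and `Ric`.

A block curvature `X` acts in the plane `(w,s)` as its coefficient there times the rotation
generator that defines `Q(g,·)`. All tensors `Y` in question are invariant under rotations inside a
block, so only mixed planes contribute, and there the coefficient is always `b`. Thus `X·Y = -b(X)
Q(g,Y)` (`curvAction_blockCurvature`), which gives every pseudosymmetry at once; each function `L`
is `-b(X)`.

The relations involving `Q(Ric,·)` live in a span of two tensors, because polarizing `Q(F, F ∧ F) =
0` gives linear relations among the Tachibana tensors of `h` and `k`
(`tachibana_blockForm_blockCurvature`). They reduce to two rational identities in `M, e, Λ, r`.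

Compatibility with a block curvature kills the mixed entries of `Z` as soon as `a, b, c` are not all
equal (`isCompatible_blockCurvature_iff_isBlockDiagonal`). For `C` and `K` this fails only where `Mr
= e²`, a single level of `r`, and continuity carries the field statement across it. -/

theorem partialDeriv_congr {n : ℕ} {F H : (Fin n → ℝ) → ℝ} {s : Set (Fin n → ℝ)} (hs : IsOpen s)
    (h : ∀ y ∈ s, F y = H y) (i : Fin n) {x : Fin n → ℝ} (hx : x ∈ s) :
    partialDeriv i F x = partialDeriv i H x := by
  have hcont : ContinuousAt (fun t : ℝ => Function.update x i t) (x i) :=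
    (continuous_const.update i continuous_id).continuousAt
  refine Filter.EventuallyEq.deriv_eq ?_
  have : s ∈ nhds (Function.update x i (x i)) := by
    rw [Function.update_eq_self]; exact hs.mem_nhds hx
  filter_upwards [hcont this] with t ht using h _ ht

/-- Partial derivatives of a product of a function of `x¹` and a function of `x²`. -/
theorem partialDeriv_separated {A B : ℝ → ℝ} {A' B' : ℝ} {x : Fin 4 → ℝ}
    (hA : HasDerivAt A A' (x 1)) (hB : HasDerivAt B B' (x 2)) (i : Fin 4) :
    partialDeriv i (fun y => A (y 1) * B (y 2)) x
      = ![0, A' * B (x 2), A (x 1) * B', 0] i := by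
  fin_cases i
  · simp [partialDeriv, Function.update]
  · simpa [partialDeriv, Function.update] using (hA.mul_const (B (x 2))).deriv
  · simpa [partialDeriv, Function.update] using (hB.const_mul (A (x 1))).deriv
  · simp [partialDeriv, Function.update]

end ChartGeometry

/-! ### Christoffel symbols and curvature of the metric -/

namespace RNdS

open ChartGeometry

/-- The derivative of the lapse function. -/
noncomputable def lapseDeriv (M e Λ r : ℝ) : ℝ :=
  2 * M / r ^ 2 - 2 * e ^ 2 / r ^ 3 - 2 * Λ * r

/-- The second derivative of the lapse function. -/
noncomputable def lapseDeriv₂ (M e Λ r : ℝ) : ℝ :=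
  -4 * M / r ^ 3 + 6 * e ^ 2 / r ^ 4 - 2 * Λ

theorem hasDerivAt_lapse (M e Λ : ℝ) {r : ℝ} (hr : r ≠ 0) :
    HasDerivAt (lapse M e Λ) (lapseDeriv M e Λ r) r := by
  have h := ((((hasDerivAt_const r (1 : ℝ)).sub ((hasDerivAt_const r (2 * M)).div
    (hasDerivAt_id r) hr)).add ((hasDerivAt_const r (e ^ 2)).div (hasDerivAt_pow 2 r)
    (pow_ne_zero 2 hr))).sub ((hasDerivAt_pow 2 r).const_mul Λ))
  refine h.congr_deriv ?_
  simp only [lapseDeriv, id]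
  field_simp
  ring

theorem hasDerivAt_lapseDeriv (M e Λ : ℝ) {r : ℝ} (hr : r ≠ 0) :
    HasDerivAt (lapseDeriv M e Λ) (lapseDeriv₂ M e Λ r) r := by
  have h := ((((hasDerivAt_const r (2 * M)).div (hasDerivAt_pow 2 r) (pow_ne_zero 2 hr)).sub
    ((hasDerivAt_const r (2 * e ^ 2)).div (hasDerivAt_pow 3 r)
    (pow_ne_zero 3 hr))).sub ((hasDerivAt_id r).const_mul (2 * Λ)))
  refine h.congr_deriv ?_
  simp only [lapseDeriv₂]
  field_simp
  ring

theorem isOpen_domain (M e Λ : ℝ) : IsOpen (domain M e Λ) := by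
  have h1 : IsOpen {x : Fin 4 → ℝ | 0 < x 1} := isOpen_lt continuous_const (continuous_apply 1)
  -- Continuity of the lapse is available only away from `r = 0`, so its nonvanishing is treated as
  -- an open condition relative to `r > 0`.
  have h2 : ContinuousOn (fun x : Fin 4 → ℝ => lapse M e Λ (x 1)) {x | 0 < x 1} := fun x hx =>
    (ContinuousAt.comp (f := fun y : Fin 4 → ℝ => y 1)
      (hasDerivAt_lapse M e Λ (ne_of_gt hx)).continuousAt
      (continuous_apply 1).continuousAt).continuousWithinAt
  have h3 := h2.isOpen_inter_preimage h1 isOpen_compl_singleton (t := {0}ᶜ)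
  have h4 : IsOpen {x : Fin 4 → ℝ | 0 < x 2} := isOpen_lt continuous_const (continuous_apply 2)
  have h5 : IsOpen {x : Fin 4 → ℝ | x 2 < Real.pi} :=
    isOpen_lt (continuous_apply 2) continuous_const
  convert (h3.inter h4).inter h5 using 1
  ext x
  simp [domain, and_assoc]

/-- The diagonal entries of the metric. -/
noncomputable def diagEntry (M e Λ : ℝ) (x : Fin 4 → ℝ) : Fin 4 → ℝ :=
  ![-lapse M e Λ (x 1), (lapse M e Λ (x 1))⁻¹, (x 1) ^ 2, (x 1) ^ 2 * (Real.sin (x 2)) ^ 2]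

theorem metric_eq (M e Λ : ℝ) (x : Fin 4 → ℝ) :
    metric M e Λ x = Matrix.diagonal (diagEntry M e Λ x) := rfl

theorem sin_pos_of_mem {M e Λ : ℝ} {x : Fin 4 → ℝ} (hx : x ∈ domain M e Λ) :
    0 < Real.sin (x 2) := Real.sin_pos_of_pos_of_lt_pi hx.2.2.1 hx.2.2.2

theorem diagEntry_ne_zero {M e Λ : ℝ} {x : Fin 4 → ℝ} (hx : x ∈ domain M e Λ) (i : Fin 4) :
    diagEntry M e Λ x i ≠ 0 := by
  have h1 := hx.1.ne'
  have h2 := hx.2.1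
  have h3 := (sin_pos_of_mem hx).ne'
  fin_cases i <;> simp [diagEntry, h1, h2, h3]

theorem inv_diagonal_of_ne_zero {n : ℕ} {d : Fin n → ℝ} (hd : ∀ i, d i ≠ 0) :
    (Matrix.diagonal d)⁻¹ = Matrix.diagonal fun i => (d i)⁻¹ := by
  refine Matrix.inv_eq_right_inv ?_
  rw [Matrix.diagonal_mul_diagonal, ← Matrix.diagonal_one]
  congr 1
  ext i
  simp [hd i]

/-- The first partial derivatives `∂_l g_{ii}` of the metric. -/
noncomputable def metricDeriv (M e Λ : ℝ) (x : Fin 4 → ℝ) (l i : Fin 4) : ℝ :=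
  !![0, 0, 0, 0;
    -lapseDeriv M e Λ (x 1), -lapseDeriv M e Λ (x 1) / lapse M e Λ (x 1) ^ 2, 2 * x 1,
      2 * x 1 * Real.sin (x 2) ^ 2;
    0, 0, 0, x 1 ^ 2 * (2 * Real.sin (x 2) * Real.cos (x 2));
    0, 0, 0, 0] l i

theorem partialDeriv_metric {M e Λ : ℝ} {x : Fin 4 → ℝ} (hx : x ∈ domain M e Λ)
    (l i j : Fin 4) :
    partialDeriv l (fun y => metric M e Λ y i j) x
      = if i = j then metricDeriv M e Λ x l i else 0 := by
  by_cases hij : i = j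
  swap
  · simp [metric, hij, partialDeriv]
  subst hij
  have h1 := hx.1.ne'
  have hf := hasDerivAt_lapse M e Λ h1
  have hone := hasDerivAt_const (x 2) (1 : ℝ)
  have hsin := (Real.hasDerivAt_sin (x 2)).pow 2
  have hsq := hasDerivAt_pow 2 (x 1)
  have hfi := hf.inv hx.2.1
  simp only [if_true]
  fin_cases i
  · have := partialDeriv_separated hf.neg hone l
    convert this using 1
    · simp [metric]
    · fin_cases l <;> simp [metricDeriv]
  · have := partialDeriv_separated hfi hone l
    convert this using 1
    · simp [metric]
    · fin_cases l <;> simp [metricDeriv]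
  · have := partialDeriv_separated hsq hone l
    convert this using 1
    · simp [metric]
    · fin_cases l <;> simp [metricDeriv]
  · have := partialDeriv_separated hsq hsin l
    convert this using 1
    · simp [metric]
    · fin_cases l <;> simp [metricDeriv]

/-- The radial factors of the Christoffel symbols. -/
noncomputable def christoffelRadial (M e Λ : ℝ) (k i j : Fin 4) (r : ℝ) : ℝ :=
  let f := lapse M e Λ r
  let f' := lapseDeriv M e Λ r
  ![!![0, f' / (2 * f), 0, 0; f' / (2 * f), 0, 0, 0; 0, 0, 0, 0; 0, 0, 0, 0],
    !![f * f' / 2, 0, 0, 0; 0, -f' / (2 * f), 0, 0; 0, 0, -(r * f), 0; 0, 0, 0, -(r * f)],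
    !![0, 0, 0, 0; 0, 0, r⁻¹, 0; 0, r⁻¹, 0, 0; 0, 0, 0, 1],
    !![0, 0, 0, 0; 0, 0, 0, r⁻¹; 0, 0, 0, 1; 0, r⁻¹, 1, 0]] k i j

/-- The derivatives of `christoffelRadial`. -/
noncomputable def christoffelRadialDeriv (M e Λ : ℝ) (k i j : Fin 4) (r : ℝ) : ℝ :=
  let f := lapse M e Λ r
  let f' := lapseDeriv M e Λ r
  let f'' := lapseDeriv₂ M e Λ r
  let q := (f'' * f - f' ^ 2) / (2 * f ^ 2)
  ![!![0, q, 0, 0; q, 0, 0, 0; 0, 0, 0, 0; 0, 0, 0, 0],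
    !![(f' * f' + f * f'') / 2, 0, 0, 0; 0, -q, 0, 0; 0, 0, -(f + r * f'), 0;
      0, 0, 0, -(f + r * f')],
    !![0, 0, 0, 0; 0, 0, -(r ^ 2)⁻¹, 0; 0, -(r ^ 2)⁻¹, 0, 0; 0, 0, 0, 0],
    !![0, 0, 0, 0; 0, 0, 0, -(r ^ 2)⁻¹; 0, 0, 0, 0; 0, -(r ^ 2)⁻¹, 0, 0]] k i j

/-- The angular factors of the Christoffel symbols. -/
noncomputable def christoffelAngular (k i j : Fin 4) (θ : ℝ) : ℝ :=
  let s := Real.sin θ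
  let c := Real.cos θ
  ![!![1, 1, 1, 1; 1, 1, 1, 1; 1, 1, 1, 1; 1, 1, 1, 1],
    !![1, 1, 1, 1; 1, 1, 1, 1; 1, 1, 1, 1; 1, 1, 1, s ^ 2],
    !![1, 1, 1, 1; 1, 1, 1, 1; 1, 1, 1, 1; 1, 1, 1, -(s * c)],
    !![1, 1, 1, 1; 1, 1, 1, 1; 1, 1, 1, c / s; 1, 1, c / s, 1]] k i j

/-- The derivatives of `christoffelAngular`. -/
noncomputable def christoffelAngularDeriv (k i j : Fin 4) (θ : ℝ) : ℝ :=
  let s := Real.sin θ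
  let c := Real.cos θ
  ![!![0, 0, 0, 0; 0, 0, 0, 0; 0, 0, 0, 0; 0, 0, 0, 0],
    !![0, 0, 0, 0; 0, 0, 0, 0; 0, 0, 0, 0; 0, 0, 0, 2 * s * c],
    !![0, 0, 0, 0; 0, 0, 0, 0; 0, 0, 0, 0; 0, 0, 0, -(c * c + s * -s)],
    !![0, 0, 0, 0; 0, 0, 0, 0; 0, 0, 0, (-s * s - c * c) / s ^ 2;
      0, 0, (-s * s - c * c) / s ^ 2, 0]] k i j

theorem hasDerivAt_christoffelRadial {M e Λ r : ℝ} (hr : r ≠ 0) (hf0 : lapse M e Λ r ≠ 0)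
    (k i j : Fin 4) :
    HasDerivAt (christoffelRadial M e Λ k i j) (christoffelRadialDeriv M e Λ k i j r) r := by
  have hf := hasDerivAt_lapse M e Λ hr
  have hf' := hasDerivAt_lapseDeriv M e Λ hr
  have hq : HasDerivAt (fun r => lapseDeriv M e Λ r / (2 * lapse M e Λ r))
      ((lapseDeriv₂ M e Λ r * lapse M e Λ r - lapseDeriv M e Λ r ^ 2) / (2 * lapse M e Λ r ^ 2))
      r := by
    refine (hf'.div (hf.const_mul 2) (mul_ne_zero two_ne_zero hf0)).congr_deriv ?_
    field_simp
  have hq' : HasDerivAt (fun r => -lapseDeriv M e Λ r / (2 * lapse M e Λ r))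
      (-((lapseDeriv₂ M e Λ r * lapse M e Λ r - lapseDeriv M e Λ r ^ 2) /
        (2 * lapse M e Λ r ^ 2))) r := by
    simp only [neg_div]
    exact hq.neg
  have hm : HasDerivAt (fun r => lapse M e Λ r * lapseDeriv M e Λ r / 2)
      ((lapseDeriv M e Λ r * lapseDeriv M e Λ r + lapse M e Λ r * lapseDeriv₂ M e Λ r) / 2) r :=
    (hf.mul hf').div_const 2
  have hrf : HasDerivAt (fun r => -(r * lapse M e Λ r))
      (-(lapse M e Λ r + r * lapseDeriv M e Λ r)) r := by
    exact ((hasDerivAt_id r).mul hf).neg.congr_deriv (by simp)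
  have hinv := hasDerivAt_inv hr
  have h0 := hasDerivAt_const r (0 : ℝ)
  have h1 := hasDerivAt_const r (1 : ℝ)
  fin_cases k <;> fin_cases i <;> fin_cases j <;>
    first
    | exact h0 | exact h1 | exact hinv | exact hq | exact hq' | exact hm | exact hrf

theorem hasDerivAt_christoffelAngular {θ : ℝ} (hs : Real.sin θ ≠ 0) (k i j : Fin 4) :
    HasDerivAt (christoffelAngular k i j) (christoffelAngularDeriv k i j θ) θ := by
  have h1 := hasDerivAt_const θ (1 : ℝ)
  have hsq : HasDerivAt (fun θ => Real.sin θ ^ 2) (2 * Real.sin θ * Real.cos θ) θ := by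
    exact ((Real.hasDerivAt_sin θ).pow 2).congr_deriv (by simp)
  have hsc := ((Real.hasDerivAt_sin θ).mul (Real.hasDerivAt_cos θ)).neg
  have hcot := (Real.hasDerivAt_cos θ).div (Real.hasDerivAt_sin θ) hs
  fin_cases k <;> fin_cases i <;> fin_cases j <;>
    first
    | exact h1 | exact hsq | exact hsc | exact hcot

/-- Every Christoffel symbol separates into a function of `r` times a function of `θ`. In this form
`partialDeriv_separated` differentiates all of them uniformly. -/
theorem christoffel_metric {M e Λ : ℝ} {x : Fin 4 → ℝ} (hx : x ∈ domain M e Λ)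
    (k i j : Fin 4) :
    christoffel (metric M e Λ) k i j x
      = christoffelRadial M e Λ k i j (x 1) * christoffelAngular k i j (x 2) := by
  have h1 := hx.1.ne'
  have h2 := hx.2.1
  have h3 := (sin_pos_of_mem hx).ne'
  have hsum : christoffel (metric M e Λ) k i j x = (1 / 2) * ((diagEntry M e Λ x k)⁻¹ *
      ((if j = k then metricDeriv M e Λ x i j else 0)
        + (if i = k then metricDeriv M e Λ x j i else 0)
        - (if i = j then metricDeriv M e Λ x k i else 0))) := by
    simp only [christoffel, partialDeriv_metric hx]
    rw [metric_eq, inv_diagonal_of_ne_zero (diagEntry_ne_zero hx),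
      Finset.sum_eq_single k (fun l _ hl => by simp [Matrix.diagonal_apply_ne' _ hl]) (by simp),
      Matrix.diagonal_apply_eq]
  rw [hsum]
  generalize hf : lapse M e Λ (x 1) = f at *
  generalize hf' : lapseDeriv M e Λ (x 1) = f'
  fin_cases k <;> fin_cases i <;> fin_cases j <;>
    simp [diagEntry, metricDeriv, christoffelRadial, christoffelAngular, hf, hf'] <;>
    field_simp

theorem partialDeriv_christoffel {M e Λ : ℝ} {x : Fin 4 → ℝ} (hx : x ∈ domain M e Λ)
    (l k i j : Fin 4) :
    partialDeriv l (christoffel (metric M e Λ) k i j) x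
      = ![0, christoffelRadialDeriv M e Λ k i j (x 1) * christoffelAngular k i j (x 2),
          christoffelRadial M e Λ k i j (x 1) * christoffelAngularDeriv k i j (x 2), 0] l := by
  rw [partialDeriv_congr (isOpen_domain M e Λ) (fun y hy => christoffel_metric hy k i j) l hx]
  exact partialDeriv_separated (hasDerivAt_christoffelRadial hx.1.ne' hx.2.1 k i j)
    (hasDerivAt_christoffelAngular (sin_pos_of_mem hx).ne' k i j) l

/-- The coefficients that equal `a` for index pairs in the first `2 × 2` block, `c` in the second
one, and `b` for mixed pairs. -/
def blockCoeff (a b c : ℝ) (i j : Fin 4) : ℝ :=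
  !![a, a, b, b; a, a, b, b; b, b, c, c; b, b, c, c] i j

/-- The curvature-like tensor of a diagonal metric whose sectional curvatures in the coordinate
planes are `blockCoeff a b c`. -/
def blockCurvature (d : Fin 4 → ℝ) (a b c : ℝ) : Tensor 4 4 := fun v =>
  blockCoeff a b c (v 0) (v 1) *
    (Matrix.diagonal d (v 0) (v 2) * Matrix.diagonal d (v 1) (v 3)
      - Matrix.diagonal d (v 0) (v 3) * Matrix.diagonal d (v 1) (v 2))

set_option maxHeartbeats 1000000 in
-- The three coefficients are the classical sectional curvatures `-f''/2`, `-f'/(2r)` and `(1 -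
-- f)/r²` of a static spherically symmetric metric.
theorem riemann_metric_aux {M e Λ : ℝ} {x : Fin 4 → ℝ} (hx : x ∈ domain M e Λ)
    (h i j k : Fin 4) (hjk : j < k) :
    riemann (metric M e Λ) x ![h, i, j, k] = blockCurvature (diagEntry M e Λ x)
      (-lapseDeriv₂ M e Λ (x 1) / 2) (-lapseDeriv M e Λ (x 1) / (2 * x 1))
      ((1 - lapse M e Λ (x 1)) / x 1 ^ 2) ![h, i, j, k] := by
  have h1 := hx.1.ne'
  have h2 := hx.2.1
  have h3 := (sin_pos_of_mem hx).ne'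
  have hs : riemann (metric M e Λ) x ![h, i, j, k] = diagEntry M e Λ x h *
    (partialDeriv j (christoffel (metric M e Λ) h i k) x
      - partialDeriv k (christoffel (metric M e Λ) h i j) x
      + ∑ β, (christoffel (metric M e Λ) β i k x * christoffel (metric M e Λ) h β j x
          - christoffel (metric M e Λ) β i j x * christoffel (metric M e Λ) h β k x)) := by
    simp only [riemann]
    rw [metric_eq, Finset.sum_eq_single h
      (fun l _ hl => by simp [Matrix.diagonal_apply_ne' _ hl]) (by simp)]
    simp
  rw [hs]
  clear hs
  simp only [partialDeriv_christoffel hx, christoffel_metric hx, Fin.sum_univ_four]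
  have hcos : Real.cos (x 2) ^ 2 = 1 - Real.sin (x 2) ^ 2 := Real.cos_sq' _
  -- The component identities are formal in `f, f', f''`; the explicit lapse plays no role until
  -- `riemann_metric_explicit`.
  generalize hf : lapse M e Λ (x 1) = f at *
  generalize hf' : lapseDeriv M e Λ (x 1) = f'
  generalize hf'' : lapseDeriv₂ M e Λ (x 1) = f''
  fin_cases j <;> fin_cases k <;> first | exact absurd hjk (by decide) | skip
  all_goals
    fin_cases h <;> fin_cases i <;>
    simp [diagEntry, blockCurvature, blockCoeff, christoffelRadial, christoffelAngular,
      christoffelRadialDeriv, christoffelAngularDeriv, hf, hf', hf'', Matrix.diagonal] <;>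
    field_simp <;> (try simp only [hcos]) <;> first | ring1 | exact Or.inr (by ring1)

theorem riemann_metric {M e Λ : ℝ} {x : Fin 4 → ℝ} (hx : x ∈ domain M e Λ) :
    riemann (metric M e Λ) x = blockCurvature (diagEntry M e Λ x)
      (-lapseDeriv₂ M e Λ (x 1) / 2) (-lapseDeriv M e Λ (x 1) / (2 * x 1))
      ((1 - lapse M e Λ (x 1)) / x 1 ^ 2) := by
  funext v
  have hv : v = ![v 0, v 1, v 2, v 3] := by
    ext p; fin_cases p <;> rfl
  rw [hv]
  generalize v 0 = h
  generalize v 1 = i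
  generalize v 2 = j
  generalize v 3 = k
  -- Skewness in the last pair is visible from the defining formula for any metric, so the
  -- components with `j < k` suffice.
  have swap : ∀ (g : ChartGeometry.Metric 4) (y),
      riemann g y ![h, i, j, k] = -riemann g y ![h, i, k, j] := by
    intro g y
    simp only [riemann, ← Finset.sum_neg_distrib]
    refine Finset.sum_congr rfl fun α _ => ?_
    simp [Finset.sum_sub_distrib]
    ring
  rcases lt_trichotomy j k with hjk | rfl | hjk
  · exact riemann_metric_aux hx h i j k hjk
  · have := swap (metric M e Λ) x
    rw [self_eq_neg.mp this]
    simp [blockCurvature]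
  · rw [swap, riemann_metric_aux hx h i k j hjk]
    simp [blockCurvature]
    ring

end RNdS

/-! ### Algebra of Tachibana tensors -/

namespace ChartGeometry

section Tachibana

variable {n m : ℕ}

theorem tachibana_add_left (A B : Tensor n 2) (Y : Tensor n m) :
    tachibana (A + B) Y = tachibana A Y + tachibana B Y := by
  funext v w s
  simp only [tachibana, Pi.add_apply, ← Finset.sum_add_distrib]
  exact Finset.sum_congr rfl fun p _ => by ring

theorem tachibana_smul_left (t : ℝ) (A : Tensor n 2) (Y : Tensor n m) :
    tachibana (t • A) Y = t • tachibana A Y := by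
  funext v w s
  simp only [tachibana, Pi.smul_apply, smul_eq_mul, Finset.mul_sum]
  exact Finset.sum_congr rfl fun p _ => by ring

theorem tachibana_add_right (A : Tensor n 2) (Y Z : Tensor n m) :
    tachibana A (Y + Z) = tachibana A Y + tachibana A Z := by
  funext v w s
  simp only [tachibana, Pi.add_apply, ← Finset.sum_add_distrib]
  exact Finset.sum_congr rfl fun p _ => by ring

theorem tachibana_smul_right (t : ℝ) (A : Tensor n 2) (Y : Tensor n m) :
    tachibana A (t • Y) = t • tachibana A Y := by
  funext v w s
  simp only [tachibana, Pi.smul_apply, smul_eq_mul, Finset.mul_sum]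
  exact Finset.sum_congr rfl fun p _ => by ring

theorem tachibana_two (A Y : Tensor n 2) (i j w s : Fin n) :
    tachibana A Y ![i, j] w s = A ![w, i] * Y ![s, j] - A ![s, i] * Y ![w, j]
      + (A ![w, j] * Y ![i, s] - A ![s, j] * Y ![i, w]) := by
  have h0 : ∀ a, Function.update ![i, j] 0 a = ![a, j] := fun a => by
    ext p; fin_cases p <;> rfl
  have h1 : ∀ a, Function.update ![i, j] 1 a = ![i, a] := fun a => by
    ext p; fin_cases p <;> rfl
  simp [tachibana, Fin.sum_univ_two, h0, h1]
  ring

theorem tachibana_four (A : Tensor n 2) (Y : Tensor n 4) (h i j k w s : Fin n) :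
    tachibana A Y ![h, i, j, k] w s =
      A ![w, h] * Y ![s, i, j, k] - A ![s, h] * Y ![w, i, j, k]
      + (A ![w, i] * Y ![h, s, j, k] - A ![s, i] * Y ![h, w, j, k])
      + (A ![w, j] * Y ![h, i, s, k] - A ![s, j] * Y ![h, i, w, k])
      + (A ![w, k] * Y ![h, i, j, s] - A ![s, k] * Y ![h, i, j, w]) := by
  have h0 : ∀ a, Function.update ![h, i, j, k] 0 a = ![a, i, j, k] := fun a => by
    ext p; fin_cases p <;> rfl
  have h1 : ∀ a, Function.update ![h, i, j, k] 1 a = ![h, a, j, k] := fun a => by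
    ext p; fin_cases p <;> rfl
  have h2 : ∀ a, Function.update ![h, i, j, k] 2 a = ![h, i, a, k] := fun a => by
    ext p; fin_cases p <;> rfl
  have h3 : ∀ a, Function.update ![h, i, j, k] 3 a = ![h, i, j, a] := fun a => by
    ext p; fin_cases p <;> rfl
  simp [tachibana, Fin.sum_univ_four, h0, h1, h2, h3]
  ring

theorem eq_vec_two (v : Fin 2 → Fin n) : v = ![v 0, v 1] := by
  ext p; fin_cases p <;> rfl

theorem eq_vec_four (v : Fin 4 → Fin n) : v = ![v 0, v 1, v 2, v 3] := by
  ext p; fin_cases p <;> rfl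

theorem tachibana_self {F : Tensor n 2} (hF : ∀ i j, F ![i, j] = F ![j, i]) :
    tachibana F F = 0 := by
  funext v w s
  rw [eq_vec_two v, tachibana_two, hF (v 0) s, hF (v 0) w]
  simp only [Pi.zero_apply]
  ring

theorem kulkarniNomizu_apply (F H : Tensor n 2) (i j k l : Fin n) :
    kulkarniNomizu F H ![i, j, k, l] = F ![i, l] * H ![k, j] - F ![i, k] * H ![l, j]
      + F ![j, k] * H ![l, i] - F ![j, l] * H ![k, i] := rfl

/-- This is the part linear in `ε` of `Q(F, F ∧ F) = 0` after replacing `F` by `F + εH`, since `F ∧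
H = H ∧ F` for symmetric tensors. -/
theorem tachibana_kulkarniNomizu_self {F : Tensor n 2} (hF : ∀ i j, F ![i, j] = F ![j, i])
    (H : Tensor n 2) (hH : ∀ i j, H ![i, j] = H ![j, i]) :
    tachibana H (kulkarniNomizu F F) + (2 : ℝ) • tachibana F (kulkarniNomizu F H) = 0 := by
  funext v w s
  rw [eq_vec_four v]
  generalize v 0 = h
  generalize v 1 = i
  generalize v 2 = j
  generalize v 3 = k
  simp only [Pi.add_apply, Pi.smul_apply, Pi.zero_apply, smul_eq_mul, tachibana_four,
    kulkarniNomizu_apply]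
  simp only [hF j h, hF k h, hF j i, hF k i, hF h s, hF i s, hF j s, hF k s, hF h w, hF i w, hF j w,
    hF k w, hH j h, hH k h, hH j i, hH k i, hH j s, hH k s, hH j w, hH k w]
  ring

end Tachibana

end ChartGeometry

/-! ### Block forms, block curvatures and their invariance -/

namespace RNdS

open ChartGeometry

/-- The weights `p` on the first `2 × 2` block and `q` on the second one. -/
def blockWeight (p q : ℝ) : Fin 4 → ℝ := ![p, p, q, q]

/-- The symmetric tensor `p h + q k`, where `h` and `k` are the two blocks of a diagonal metric. -/
def blockForm (d : Fin 4 → ℝ) (p q : ℝ) : Tensor 4 2 := fun v =>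
  blockWeight p q (v 0) * Matrix.diagonal d (v 0) (v 1)

variable {d : Fin 4 → ℝ}

theorem blockForm_apply (p q : ℝ) (i j : Fin 4) :
    blockForm d p q ![i, j] = blockWeight p q i * Matrix.diagonal d i j := rfl

theorem diagonal_comm (i j : Fin 4) : Matrix.diagonal d i j = Matrix.diagonal d j i := by
  rw [← Matrix.transpose_apply (Matrix.diagonal d), Matrix.diagonal_transpose]

theorem blockForm_apply' (p q : ℝ) (i j : Fin 4) :
    blockForm d p q ![i, j] = blockWeight p q j * Matrix.diagonal d j i := by
  rw [blockForm_apply]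
  rcases eq_or_ne i j with rfl | h
  · rfl
  · simp [Matrix.diagonal_apply_ne _ h, Matrix.diagonal_apply_ne' _ h]

theorem blockForm_symm (p q : ℝ) (i j : Fin 4) :
    blockForm d p q ![i, j] = blockForm d p q ![j, i] := by
  rw [blockForm_apply, blockForm_apply']

theorem blockForm_eq (p q : ℝ) : blockForm d p q = p • blockForm d 1 0 + q • blockForm d 0 1 := by
  funext v
  simp only [blockForm, Pi.add_apply, Pi.smul_apply, smul_eq_mul, ← mul_assoc, ← add_mul]
  generalize v 0 = i
  congr 1
  fin_cases i <;> simp [blockWeight]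

theorem blockCurvature_apply (a b c : ℝ) (h i j k : Fin 4) :
    blockCurvature d a b c ![h, i, j, k] = blockCoeff a b c h i *
      (Matrix.diagonal d h j * Matrix.diagonal d i k
        - Matrix.diagonal d h k * Matrix.diagonal d i j) := rfl

/-- Pair symmetry: the metric factor vanishes unless `{h,i} = {j,k}`, so the coefficient may be read
off from either pair. -/
theorem blockCurvature_apply' (a b c : ℝ) (h i j k : Fin 4) :
    blockCurvature d a b c ![h, i, j, k] = blockCoeff a b c j k *
      (Matrix.diagonal d h j * Matrix.diagonal d i k
        - Matrix.diagonal d h k * Matrix.diagonal d i j) := by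
  have hsymm : blockCoeff a b c h i = blockCoeff a b c i h := by
    fin_cases h <;> fin_cases i <;> rfl
  rw [blockCurvature_apply]
  by_cases h1 : h = j ∧ i = k
  · rw [h1.1, h1.2]
  by_cases h2 : h = k ∧ i = j
  · rw [hsymm, h2.1, h2.2]
  have e1 : Matrix.diagonal d h j * Matrix.diagonal d i k = 0 := by
    rcases not_and_or.mp h1 with h1 | h1 <;> simp [Matrix.diagonal_apply_ne _ h1]
  have e2 : Matrix.diagonal d h k * Matrix.diagonal d i j = 0 := by
    rcases not_and_or.mp h2 with h2 | h2 <;> simp [Matrix.diagonal_apply_ne _ h2]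
  rw [e1, e2]
  ring

/-- For diagonal tensors the product has coefficient `-(F_i H_j + F_j H_i)` on the plane `(i,j)`, in
terms of weights relative to the metric. All corrections by `g ∧ Ric` and `g ∧ g` therefore stay
within block curvatures. -/
theorem kulkarniNomizu_blockForm (p q p' q' : ℝ) :
    kulkarniNomizu (blockForm d p q) (blockForm d p' q')
      = blockCurvature d (-(2 * p * p')) (-(p * q' + q * p')) (-(2 * q * q')) := by
  funext v
  rw [eq_vec_four v, kulkarniNomizu_apply, blockCurvature_apply]
  have hc : blockCoeff (-(2 * p * p')) (-(p * q' + q * p')) (-(2 * q * q')) (v 0) (v 1)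
      = -(blockWeight p q (v 0) * blockWeight p' q' (v 1)
        + blockWeight p q (v 1) * blockWeight p' q' (v 0)) := by
    generalize v 0 = h
    generalize v 1 = i
    fin_cases h <;> fin_cases i <;> simp [blockCoeff, blockWeight] <;> ring
  rw [hc, blockForm_apply p q, blockForm_apply p q, blockForm_apply p q, blockForm_apply p q,
    blockForm_apply' p' q', blockForm_apply' p' q', blockForm_apply' p' q', blockForm_apply' p' q']
  ring

theorem blockCurvature_add (a b c a' b' c' : ℝ) :
    blockCurvature d a b c + blockCurvature d a' b' c'
      = blockCurvature d (a + a') (b + b') (c + c') := by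
  funext v
  simp only [blockCurvature, Pi.add_apply, ← add_mul]
  generalize v 0 = h
  generalize v 1 = i
  congr 1
  fin_cases h <;> fin_cases i <;> simp [blockCoeff]

theorem smul_blockCurvature (t a b c : ℝ) :
    t • blockCurvature d a b c = blockCurvature d (t * a) (t * b) (t * c) := by
  funext v
  simp only [blockCurvature, Pi.smul_apply, smul_eq_mul, ← mul_assoc]
  generalize v 0 = h
  generalize v 1 = i
  congr 1
  fin_cases h <;> fin_cases i <;> simp [blockCoeff]

/-- A linear relation between Tachibana tensors of block forms and block curvatures amounts to
two scalar equations. -/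
theorem tachibana_blockForm_blockCurvature (p q a b c : ℝ) :
    tachibana (blockForm d p q) (blockCurvature d a b c)
      = (p * b - q * a) • tachibana (blockForm d 1 0) (blockCurvature d 0 1 0)
        + (p * c - q * b) • tachibana (blockForm d 1 0) (blockCurvature d 0 0 1) := by
  have h₁ := blockForm_symm (d := d) 1 0
  have h₂ := blockForm_symm (d := d) 0 1
  -- With `A, B, C` the block curvatures of coefficients `(1,0,0)`, `(0,1,0)`, `(0,0,1)`, these four
  -- instances amount to `Q(h,A) = 0`, `Q(k,A) = -Q(h,B)`, `Q(k,B) = -Q(h,C)` and `Q(k,C) = 0`. Only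
  -- `Q(h,B)` and `Q(h,C)` survive.
  have hh := tachibana_kulkarniNomizu_self h₁ _ h₁
  have hk := tachibana_kulkarniNomizu_self h₁ _ h₂
  have kh := tachibana_kulkarniNomizu_self h₂ _ h₁
  have kk := tachibana_kulkarniNomizu_self h₂ _ h₂
  have eA : kulkarniNomizu (blockForm d 1 0) (blockForm d 1 0)
      = (-2 : ℝ) • blockCurvature d 1 0 0 := by
    rw [kulkarniNomizu_blockForm, smul_blockCurvature]; norm_num
  have eB : kulkarniNomizu (blockForm d 1 0) (blockForm d 0 1)
      = (-1 : ℝ) • blockCurvature d 0 1 0 := by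
    rw [kulkarniNomizu_blockForm, smul_blockCurvature]; norm_num
  have eB' : kulkarniNomizu (blockForm d 0 1) (blockForm d 1 0)
      = (-1 : ℝ) • blockCurvature d 0 1 0 := by
    rw [kulkarniNomizu_blockForm, smul_blockCurvature]; norm_num
  have eC : kulkarniNomizu (blockForm d 0 1) (blockForm d 0 1)
      = (-2 : ℝ) • blockCurvature d 0 0 1 := by
    rw [kulkarniNomizu_blockForm, smul_blockCurvature]; norm_num
  have e : blockCurvature d a b c = a • blockCurvature d 1 0 0 + b • blockCurvature d 0 1 0
      + c • blockCurvature d 0 0 1 := by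
    simp [smul_blockCurvature, blockCurvature_add]
  rw [eA] at hh hk
  rw [eB] at hk
  rw [eB', eC] at kh
  rw [eC] at kk
  rw [e, blockForm_eq p q]
  simp only [tachibana_add_left, tachibana_smul_left, tachibana_add_right,
    tachibana_smul_right] at hh hk kh kk ⊢
  funext v w s
  replace hh := congrFun (congrFun (congrFun hh v) w) s
  replace hk := congrFun (congrFun (congrFun hk v) w) s
  replace kh := congrFun (congrFun (congrFun kh v) w) s
  replace kk := congrFun (congrFun (congrFun kk v) w) s
  simp only [Pi.add_apply, Pi.smul_apply, Pi.zero_apply, smul_eq_mul] at *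
  linear_combination (-a * p / 6) * hh - (a * q / 2) * hk - (b * q / 2) * kh - (c * q / 6) * kk

/-- Two indices belong to the same `2 × 2` block. -/
def SameBlock (w s : Fin 4) : Prop := ∀ p q, blockWeight p q w = blockWeight p q s

/-- The dichotomy behind all pseudosymmetries: in a plane inside a block the invariance of `Y`
applies, and every other plane has coefficient `b`. -/
theorem sameBlock_or (w s : Fin 4) : SameBlock w s ∨ ∀ a b c, blockCoeff a b c w s = b := by
  fin_cases w <;> fin_cases s <;> simp [SameBlock, blockWeight, blockCoeff]

/-- `Y` is annihilated by the infinitesimal isometries of the two blocks of a diagonal metric. -/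
def IsBlockInvariant {m : ℕ} (d : Fin 4 → ℝ) (Y : Tensor 4 m) : Prop :=
  ∀ v w s, SameBlock w s → tachibana (blockForm d 1 1) Y v w s = 0

theorem IsBlockInvariant.add {m : ℕ} {Y Z : Tensor 4 m} (hY : IsBlockInvariant d Y)
    (hZ : IsBlockInvariant d Z) : IsBlockInvariant d (Y + Z) := fun v w s h => by
  simp [tachibana_add_right, hY v w s h, hZ v w s h]

theorem IsBlockInvariant.smul {m : ℕ} {Y : Tensor 4 m} (hY : IsBlockInvariant d Y) (t : ℝ) :
    IsBlockInvariant d (t • Y) := fun v w s h => by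
  simp [tachibana_smul_right, hY v w s h]

theorem isBlockInvariant_blockForm (p q : ℝ) : IsBlockInvariant d (blockForm d p q) := by
  intro v w s h
  rw [eq_vec_two v, tachibana_two]
  simp only [blockForm_apply, blockForm_apply' p q (v 0), h p q, h 1 1]
  ring

/-- When `w` and `s` share a block, every form evaluated on either index carries the same weight.
The weights factor out and the terms cancel in pairs, as they do for the metric itself. -/
theorem isBlockInvariant_kulkarniNomizu (p q p' q' : ℝ) :
    IsBlockInvariant d (kulkarniNomizu (blockForm d p q) (blockForm d p' q')) := by
  intro v w s hws
  rw [eq_vec_four v]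
  generalize v 0 = h
  generalize v 1 = i
  generalize v 2 = j
  generalize v 3 = k
  have e1 : ∀ p q x, blockForm d p q ![s, x] = blockWeight p q s * Matrix.diagonal d s x :=
    fun p q x => rfl
  have e2 : ∀ p q x, blockForm d p q ![w, x] = blockWeight p q s * Matrix.diagonal d w x :=
    fun p q x => by rw [← hws]; rfl
  have e3 : ∀ p q x, blockForm d p q ![x, s] = blockWeight p q s * Matrix.diagonal d s x :=
    fun p q x => by rw [blockForm_apply']
  have e4 : ∀ p q x, blockForm d p q ![x, w] = blockWeight p q s * Matrix.diagonal d w x :=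
    fun p q x => by rw [blockForm_apply', hws]
  have e0 : blockWeight 1 1 s = 1 := by fin_cases s <;> rfl
  simp only [tachibana_four, kulkarniNomizu_apply, e1, e2, e3, e4, e0]
  ring

theorem isBlockInvariant_blockCurvature (a b c : ℝ) :
    IsBlockInvariant d (blockCurvature d a b c) := by
  have e : blockCurvature d a b c
      = (-a / 2) • kulkarniNomizu (blockForm d 1 0) (blockForm d 1 0)
        + (-b) • kulkarniNomizu (blockForm d 1 0) (blockForm d 0 1)
        + (-c / 2) • kulkarniNomizu (blockForm d 0 1) (blockForm d 0 1) := by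
    simp only [kulkarniNomizu_blockForm, smul_blockCurvature, blockCurvature_add]
    congr 1 <;> ring
  rw [e]
  exact (((isBlockInvariant_kulkarniNomizu _ _ _ _).smul _).add
    ((isBlockInvariant_kulkarniNomizu _ _ _ _).smul _)).add
    ((isBlockInvariant_kulkarniNomizu _ _ _ _).smul _)

/-- The tensor `F_{hk} H_{ij} - F_{ik} H_{hj}`. -/
def skewProduct (F H : Tensor 4 2) : Tensor 4 4 := fun v =>
  F ![v 0, v 3] * H ![v 1, v 2] - F ![v 1, v 3] * H ![v 0, v 2]

theorem skewProduct_apply (F H : Tensor 4 2) (h i j k : Fin 4) :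
    skewProduct F H ![h, i, j, k] = F ![h, k] * H ![i, j] - F ![i, k] * H ![h, j] := rfl

theorem isBlockInvariant_skewProduct (p q p' q' : ℝ) :
    IsBlockInvariant d (skewProduct (blockForm d p q) (blockForm d p' q')) := by
  intro v w s hws
  rw [eq_vec_four v]
  generalize v 0 = h
  generalize v 1 = i
  generalize v 2 = j
  generalize v 3 = k
  have e1 : ∀ p q x, blockForm d p q ![s, x] = blockWeight p q s * Matrix.diagonal d s x :=
    fun p q x => rfl
  have e2 : ∀ p q x, blockForm d p q ![w, x] = blockWeight p q s * Matrix.diagonal d w x :=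
    fun p q x => by rw [← hws]; rfl
  have e3 : ∀ p q x, blockForm d p q ![x, s] = blockWeight p q s * Matrix.diagonal d s x :=
    fun p q x => by rw [blockForm_apply']
  have e4 : ∀ p q x, blockForm d p q ![x, w] = blockWeight p q s * Matrix.diagonal d w x :=
    fun p q x => by rw [blockForm_apply', hws]
  simp only [tachibana_four, skewProduct_apply, e1, e2, e3, e4]
  ring

/-! ### Action of curvature tensors on block-invariant tensors -/

section Pointwise

variable {g : ChartGeometry.Metric 4} {x : Fin 4 → ℝ}

theorem metricTensor_eq_blockForm (hg : g x = Matrix.diagonal d) :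
    metricTensor g x = blockForm d 1 1 := by
  funext v
  have e0 : blockWeight 1 1 (v 0) = 1 := by generalize v 0 = s; fin_cases s <;> rfl
  simp [metricTensor, blockForm, hg, e0]

/-- Contraction of a block curvature with the inverse metric. -/
theorem sum_blockCurvature_mul_inv (hg : g x = Matrix.diagonal d) (hd : ∀ i, d i ≠ 0)
    (a b c : ℝ) (w s i α : Fin 4) :
    ∑ k, blockCurvature d a b c ![w, s, i, k] * (g x)⁻¹ k α
      = blockCoeff a b c w s * (Matrix.diagonal d w i * (if s = α then 1 else 0)
        - Matrix.diagonal d s i * (if w = α then 1 else 0)) := by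
  rw [hg, inv_diagonal_of_ne_zero hd, Finset.sum_eq_single α
    (fun k _ hk => by simp [Matrix.diagonal_apply_ne _ hk]) (by simp), Matrix.diagonal_apply_eq,
    blockCurvature_apply]
  have e : ∀ t, Matrix.diagonal d t α * (d α)⁻¹ = if t = α then 1 else 0 := by
    intro t
    split_ifs with h
    · rw [h, Matrix.diagonal_apply_eq, mul_inv_cancel₀ (hd α)]
    · rw [Matrix.diagonal_apply_ne _ h, zero_mul]
  rw [← e s, ← e w]
  ring

/-- Raising the last index turns a block curvature into its plane coefficient times the rotation
generator that defines `Q(g,·)`. No invariance of `Y` is needed yet. -/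
theorem curvAction_blockCurvature_apply (hg : g x = Matrix.diagonal d) (hd : ∀ i, d i ≠ 0)
    (a b c : ℝ) {m : ℕ} (Y : Tensor 4 m) (v : Fin m → Fin 4) (w s : Fin 4) :
    curvAction g x (blockCurvature d a b c) Y v w s
      = -blockCoeff a b c w s * tachibana (blockForm d 1 1) Y v w s := by
  have e0 : ∀ s, blockWeight 1 1 s = 1 := fun s => by fin_cases s <;> rfl
  rw [curvAction, neg_mul, tachibana, Finset.mul_sum]
  congr 1
  refine Finset.sum_congr rfl fun p _ => ?_
  simp only [sum_blockCurvature_mul_inv hg hd, blockForm_apply, e0, mul_assoc, sub_mul,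
    ite_mul, zero_mul, one_mul, ← Finset.mul_sum, Finset.sum_sub_distrib, mul_ite, mul_zero, Finset.sum_ite_eq, Finset.mem_univ, if_true]

theorem curvAction_blockCurvature (hg : g x = Matrix.diagonal d) (hd : ∀ i, d i ≠ 0)
    (a b c : ℝ) {m : ℕ} {Y : Tensor 4 m} (hY : IsBlockInvariant d Y) :
    curvAction g x (blockCurvature d a b c) Y = (-b) • tachibana (blockForm d 1 1) Y := by
  funext v w s
  rw [curvAction_blockCurvature_apply hg hd]
  simp only [Pi.smul_apply, smul_eq_mul]
  rcases sameBlock_or w s with h | h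
  · rw [hY v w s h, mul_zero, mul_zero]
  · rw [h]

theorem curvAction_sub_smul {m : ℕ} (X X' : Tensor 4 4) (t : ℝ) (Y : Tensor 4 m) :
    curvAction g x (X - t • X') Y = curvAction g x X Y - t • curvAction g x X' Y := by
  funext v w s
  simp only [curvAction, Pi.sub_apply, Pi.smul_apply, smul_eq_mul, sub_mul,
    Finset.sum_sub_distrib, mul_neg, Finset.mul_sum, Finset.sum_mul, mul_assoc]
  ring

/-- Raising the index on the metric factor gives a Kronecker delta, so the derivation is the one
defining `Q(H,·)`. This handles the Ricci correction in `P`. -/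
theorem curvAction_skewProduct (hg : g x = Matrix.diagonal d) (hd : ∀ i, d i ≠ 0)
    (H : Tensor 4 2) {m : ℕ} (Y : Tensor 4 m) :
    curvAction g x (skewProduct (blockForm d 1 1) H) Y = tachibana H Y := by
  have e0 : ∀ s, blockWeight 1 1 s = 1 := fun s => by fin_cases s <;> rfl
  have e : ∀ w s i α : Fin 4, ∑ k, skewProduct (blockForm d 1 1) H ![w, s, i, k] * (g x)⁻¹ k α
      = H ![s, i] * (if w = α then 1 else 0) - H ![w, i] * (if s = α then 1 else 0) := by
    intro w s i α
    rw [hg, inv_diagonal_of_ne_zero hd, Finset.sum_eq_single α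
      (fun k _ hk => by simp [Matrix.diagonal_apply_ne _ hk]) (by simp), Matrix.diagonal_apply_eq,
      skewProduct_apply, blockForm_apply, blockForm_apply, e0, e0]
    have e : ∀ t, Matrix.diagonal d t α * (d α)⁻¹ = if t = α then 1 else 0 := by
      intro t
      split_ifs with h
      · rw [h, Matrix.diagonal_apply_eq, mul_inv_cancel₀ (hd α)]
      · rw [Matrix.diagonal_apply_ne _ h, zero_mul]
    rw [← e s, ← e w]
    ring
  funext v w s
  simp only [curvAction, tachibana, e, ← Finset.sum_neg_distrib]
  refine Finset.sum_congr rfl fun p _ => ?_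
  simp only [mul_assoc, sub_mul, ite_mul, zero_mul, one_mul, neg_sub,
    Finset.sum_sub_distrib, mul_ite, mul_zero, Finset.sum_ite_eq, Finset.mem_univ, if_true]

/-! ### Derived curvature tensors in terms of `a, b, c`, and compatibility -/

variable {a b c : ℝ}

theorem ricci_eq_blockForm (hg : g x = Matrix.diagonal d) (hd : ∀ i, d i ≠ 0)
    (hR : riemann g x = blockCurvature d a b c) :
    ricci g x = blockForm d (-(a + 2 * b)) (-(2 * b + c)) := by
  funext v
  rw [eq_vec_two v]
  simp only [ricci, hR, hg, inv_diagonal_of_ne_zero hd, Matrix.diagonal_apply, ite_mul, zero_mul,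
    Finset.sum_ite_eq, Finset.mem_univ, if_true]
  generalize v 0 = i
  generalize v 1 = j
  have h0 := hd 0
  have h1 := hd 1
  have h2 := hd 2
  have h3 := hd 3
  fin_cases i <;> fin_cases j <;>
    simp [Fin.sum_univ_four, blockCurvature, blockCoeff, blockForm, blockWeight] <;>
    field_simp <;> ring

theorem scalarCurvature_eq (hg : g x = Matrix.diagonal d) (hd : ∀ i, d i ≠ 0)
    (hR : riemann g x = blockCurvature d a b c) :
    scalarCurvature g x = -(2 * a + 8 * b + 2 * c) := by
  have h0 := hd 0
  have h1 := hd 1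
  have h2 := hd 2
  have h3 := hd 3
  simp only [scalarCurvature, ricci_eq_blockForm hg hd hR, hg, inv_diagonal_of_ne_zero hd,
    Matrix.diagonal_apply, ite_mul, zero_mul, Finset.sum_ite_eq, Finset.mem_univ, if_true]
  simp [Fin.sum_univ_four, blockForm, blockWeight]
  field_simp
  ring

theorem conharmonic_eq (hg : g x = Matrix.diagonal d) (hd : ∀ i, d i ≠ 0)
    (hR : riemann g x = blockCurvature d a b c) :
    conharmonic g x = blockCurvature d (-(2 * b)) (-(a + 2 * b + c) / 2) (-(2 * b)) := by
  rw [conharmonic, ricci_eq_blockForm hg hd hR, metricTensor_eq_blockForm hg, hR,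
    kulkarniNomizu_blockForm, sub_eq_add_neg, ← neg_smul, smul_blockCurvature, blockCurvature_add]
  congr 1 <;> push_cast <;> ring

/-- Trace-freeness leaves a single parameter `a - 2b + c`. The mixed coefficient is the same as in
`concircular_eq`, which is why `C` and `W` act alike. -/
theorem conformal_eq (hg : g x = Matrix.diagonal d) (hd : ∀ i, d i ≠ 0)
    (hR : riemann g x = blockCurvature d a b c) :
    conformal g x = blockCurvature d ((a - 2 * b + c) / 3) (-(a - 2 * b + c) / 6)
      ((a - 2 * b + c) / 3) := by
  have hK := conharmonic_eq hg hd hR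
  rw [conharmonic] at hK
  rw [conformal, hK, metricTensor_eq_blockForm hg, scalarCurvature_eq hg hd hR,
    kulkarniNomizu_blockForm, smul_blockCurvature, blockCurvature_add]
  congr 1 <;> push_cast <;> ring

theorem concircular_eq (hg : g x = Matrix.diagonal d) (hd : ∀ i, d i ≠ 0)
    (hR : riemann g x = blockCurvature d a b c) :
    concircular g x = blockCurvature d (a - (a + 4 * b + c) / 6) (b - (a + 4 * b + c) / 6)
      (c - (a + 4 * b + c) / 6) := by
  rw [concircular, scalarCurvature_eq hg hd hR, metricTensor_eq_blockForm hg, hR,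
    kulkarniNomizu_blockForm, sub_eq_add_neg, ← neg_smul, smul_blockCurvature, blockCurvature_add]
  congr 1 <;> push_cast <;> ring

theorem projective_eq (hg : g x = Matrix.diagonal d) :
    projective g x = riemann g x
      - (1 / 3 : ℝ) • skewProduct (blockForm d 1 1) (ricci g x) := by
  have hG := metricTensor_eq_blockForm hg
  have e : ∀ i j, g x i j = blockForm d 1 1 ![i, j] := fun i j => by rw [← hG]; rfl
  funext v
  simp only [projective, e, Pi.sub_apply, Pi.smul_apply, smul_eq_mul, skewProduct]
  norm_num

theorem ricciSq_eq (hg : g x = Matrix.diagonal d) (hd : ∀ i, d i ≠ 0) {p q : ℝ}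
    (hRic : ricci g x = blockForm d p q) : ricciSq g x = blockForm d (p ^ 2) (q ^ 2) := by
  funext v
  rw [eq_vec_two v]
  simp only [ricciSq, hRic, hg, inv_diagonal_of_ne_zero hd]
  generalize v 0 = i
  generalize v 1 = j
  have hi := hd i
  fin_cases i <;> fin_cases j <;>
    simp [blockForm, blockWeight, Matrix.diagonal_apply] <;>
    field_simp

/-- Compatibility with a tensor of the form `g_{mi} α_{qij} - g_{mj} α_{qji}`. -/
theorem isCompatible_iff (hg : g x = Matrix.diagonal d) (hd : ∀ i, d i ≠ 0) {B : Tensor 4 4}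
    {α : Fin 4 → Fin 4 → Fin 4 → ℝ}
    (hB : ∀ m q i j, B ![m, q, i, j]
      = Matrix.diagonal d m i * α q i j - Matrix.diagonal d m j * α q j i)
    {Z : Matrix (Fin 4) (Fin 4) ℝ} (hZ : Z.IsSymm) :
    IsCompatible g x B Z ↔ ∀ q i j k, Z i j * (α q j k - α q i k) + Z j k * (α q k i - α q j i)
      + Z i k * (α q i j - α q k j) = 0 := by
  have hendo : ∀ m i, endo g x Z m i = (d m)⁻¹ * Z m i := by
    intro m i
    rw [endo, hg, inv_diagonal_of_ne_zero hd, Finset.sum_eq_single m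
      (fun k _ hk => by simp [Matrix.diagonal_apply_ne' _ hk]) (by simp),
      Matrix.diagonal_apply_eq]
  have hcontr : ∀ i j, ∑ m, endo g x Z m i * Matrix.diagonal d m j = Z j i := by
    intro i j
    rw [Finset.sum_eq_single j
      (fun k _ hk => by simp [Matrix.diagonal_apply_ne _ hk]) (by simp),
      Matrix.diagonal_apply_eq, hendo, mul_comm, ← mul_assoc, mul_inv_cancel₀ (hd j), one_mul]
  have hsum : ∀ q i j k, ∑ m, endo g x Z m i * B ![m, q, j, k]
      = Z j i * α q j k - Z k i * α q k j := by
    intro q i j k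
    simp only [hB, mul_sub, Finset.sum_sub_distrib, ← mul_assoc, ← Finset.sum_mul, hcontr]
  simp only [IsCompatible, Finset.sum_add_distrib, hsum]
  refine forall_congr' fun q => forall_congr' fun i => forall_congr' fun j =>
    forall_congr' fun k => ?_
  rw [hZ.apply i j, hZ.apply j k, hZ.apply i k]
  constructor <;> intro h <;> linear_combination h

theorem isCompatible_blockCurvature_iff (hg : g x = Matrix.diagonal d) (hd : ∀ i, d i ≠ 0)
    {Z : Matrix (Fin 4) (Fin 4) ℝ} (hZ : Z.IsSymm) :
    IsCompatible g x (blockCurvature d a b c) Z ↔ ∀ q i j k : Fin 4,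
      Z i j * (blockCoeff a b c j k - blockCoeff a b c i k) * Matrix.diagonal d q k
      + Z j k * (blockCoeff a b c k i - blockCoeff a b c j i) * Matrix.diagonal d q i
      + Z i k * (blockCoeff a b c i j - blockCoeff a b c k j) * Matrix.diagonal d q j = 0 := by
  have hsymm : ∀ h i, blockCoeff a b c h i = blockCoeff a b c i h := fun h i => by
    fin_cases h <;> fin_cases i <;> rfl
  rw [isCompatible_iff hg hd (α := fun q i j => blockCoeff a b c i j * Matrix.diagonal d q j)
    (fun m q i j => ?_) hZ]
  · refine forall_congr' fun q => forall_congr' fun i => forall_congr' fun j =>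
      forall_congr' fun k => ?_
    constructor <;> intro h <;> linear_combination h
  · rw [blockCurvature_apply', hsymm j i]
    ring

theorem isCompatible_of_isBlockDiagonal (hg : g x = Matrix.diagonal d) (hd : ∀ i, d i ≠ 0)
    (a b c : ℝ) {Z : Matrix (Fin 4) (Fin 4) ℝ} (hZ : Z.IsSymm) (h : IsBlockDiagonal Z) :
    IsCompatible g x (blockCurvature d a b c) Z := by
  obtain ⟨h1, h2, h3, h4, h5, h6, h7, h8⟩ := h
  -- Either `i` and `j` lie in different blocks and `Z i j = 0`, or they share a block and the two
  -- coefficients agree.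
  have key : ∀ i j k, Z i j * (blockCoeff a b c j k - blockCoeff a b c i k) = 0 := by
    intro i j k
    fin_cases i <;> fin_cases j <;>
      simp [h1, h2, h3, h4, h5, h6, h7, h8, blockCoeff]
  have hsymm : ∀ h i, blockCoeff a b c h i = blockCoeff a b c i h := fun h i => by
    fin_cases h <;> fin_cases i <;> rfl
  rw [isCompatible_blockCurvature_iff hg hd hZ]
  intro q i j k
  have e : Z i k * (blockCoeff a b c i j - blockCoeff a b c k j) = 0 := by
    linear_combination -key i k j
  rw [key, key, e]
  ring

theorem isCompatible_blockCurvature_iff_isBlockDiagonal (hg : g x = Matrix.diagonal d)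
    (hd : ∀ i, d i ≠ 0) (habc : a ≠ b ∨ c ≠ b) {Z : Matrix (Fin 4) (Fin 4) ℝ} (hZ : Z.IsSymm) :
    IsCompatible g x (blockCurvature d a b c) Z ↔ IsBlockDiagonal Z := by
  refine ⟨fun h => ?_, isCompatible_of_isBlockDiagonal hg hd a b c hZ⟩
  rw [isCompatible_blockCurvature_iff hg hd hZ] at h
  have h0 := hd 0
  have h1 := hd 1
  have h2 := hd 2
  have h3 := hd 3
  have key : Z 0 2 = 0 ∧ Z 0 3 = 0 ∧ Z 1 2 = 0 ∧ Z 1 3 = 0 := by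
    rcases habc with hab | hcb
    · have hab' := sub_ne_zero.mpr hab.symm
      -- Taking `i` and `j` in different blocks and `k = q` distinct from both leaves one term. With
      -- `k` in the first block it is `Z i j * (b - a)` times a metric entry; in the other case `k`
      -- lies in the second block and the factor is `c - b`.
      have a1 := h 1 0 2 1
      have a2 := h 1 0 3 1
      have a3 := h 0 1 2 0
      have a4 := h 0 1 3 0
      simp [blockCoeff, h0, h1, hab'] at a1 a2 a3 a4
      exact ⟨a1, a2, a3, a4⟩
    · have hcb' := sub_ne_zero.mpr hcb
      have a1 := h 3 0 2 3
      have a2 := h 2 0 3 2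
      have a3 := h 3 1 2 3
      have a4 := h 2 1 3 2
      simp [blockCoeff, h2, h3, hcb'] at a1 a2 a3 a4
      exact ⟨a1, a2, a3, a4⟩
  obtain ⟨k1, k2, k3, k4⟩ := key
  refine ⟨k1, k2, k3, k4, ?_, ?_, ?_, ?_⟩ <;> rw [hZ.apply] <;> assumption

/-- The Ricci correction adds to `α q i j` a term depending only on `q` and `j`. The criterion
involves only differences of `α` with equal first and last index, so this term drops out. -/
theorem isCompatible_projectiveSkewLast_iff (hg : g x = Matrix.diagonal d) (hd : ∀ i, d i ≠ 0)
    (hR : riemann g x = blockCurvature d a b c) {Z : Matrix (Fin 4) (Fin 4) ℝ} (hZ : Z.IsSymm) :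
    IsCompatible g x (projectiveSkewLast g x) Z ↔ IsCompatible g x (riemann g x) Z := by
  have hsymm : ∀ h i, blockCoeff a b c h i = blockCoeff a b c i h := fun h i => by
    fin_cases h <;> fin_cases i <;> rfl
  have e0 : ∀ s, blockWeight 1 1 s = 1 := fun s => by fin_cases s <;> rfl
  rw [hR, isCompatible_blockCurvature_iff hg hd hZ, isCompatible_iff hg hd
    (α := fun q i j => -(blockCoeff a b c i j * Matrix.diagonal d q j)
      - 1 / 3 * ricci g x ![j, q]) (fun m q i j => ?_) hZ]
  · refine forall_congr' fun q => forall_congr' fun i => forall_congr' fun j =>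
      forall_congr' fun k => ?_
    constructor <;> intro h <;> linear_combination -h
  · have e : projectiveSkewLast g x ![m, q, i, j] = projective g x ![i, j, q, m] := rfl
    rw [e, projective_eq hg, hR]
    simp only [Pi.sub_apply, Pi.smul_apply, smul_eq_mul, skewProduct_apply, blockForm_apply, e0,
      blockCurvature_apply, hsymm j i, diagonal_comm m, diagonal_comm q]
    ring

end Pointwise

/-! ### Explicit coefficients and the degenerate locus `Mr = e²` -/

theorem riemann_metric_explicit {M e Λ : ℝ} {x : Fin 4 → ℝ} (hx : x ∈ domain M e Λ) :
    riemann (metric M e Λ) x = blockCurvature (diagEntry M e Λ x)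
      (2 * M / x 1 ^ 3 - 3 * e ^ 2 / x 1 ^ 4 + Λ) (-M / x 1 ^ 3 + e ^ 2 / x 1 ^ 4 + Λ)
      (2 * M / x 1 ^ 3 - e ^ 2 / x 1 ^ 4 + Λ) := by
  have h1 := hx.1.ne'
  rw [riemann_metric hx]
  congr 1 <;> simp only [lapse, lapseDeriv, lapseDeriv₂] <;> field_simp <;> ring

theorem rank_blockForm {d : Fin 4 → ℝ} (hd : ∀ i, d i ≠ 0) {q : ℝ} (hq : q ≠ 0) :
    (Matrix.of fun i j => blockForm d 0 q ![i, j]).rank = 2 := by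
  have e : (Matrix.of fun i j => blockForm d 0 q ![i, j])
      = Matrix.diagonal fun i => blockWeight 0 q i * d i := by
    ext i j
    simp [blockForm_apply, Matrix.diagonal_apply]
  have h2 := hd 2
  have h3 := hd 3
  rw [e, Matrix.rank_diagonal, Fintype.card_subtype]
  have : (Finset.univ.filter fun i : Fin 4 => blockWeight 0 q i * d i ≠ 0) = {2, 3} := by
    ext i
    fin_cases i <;> simp [blockWeight, hq, h2, h3]
  rw [this]
  rfl

/-- Continuous extension across the coordinate level sets `x¹ = r₀`. -/
theorem eq_zero_of_forall_ne {U : Set (Fin 4 → ℝ)} (hU : IsOpen U) {F : (Fin 4 → ℝ) → ℝ}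
    (hF : ContinuousOn F U) {r₀ : ℝ} (h : ∀ x ∈ U, x 1 ≠ r₀ → F x = 0) :
    ∀ x ∈ U, F x = 0 := by
  intro x hx
  by_cases hr : x 1 = r₀
  swap
  · exact h x hx hr
  have hc : ContinuousAt (fun t : ℝ => Function.update x 1 t) (x 1) :=
    (continuous_const.update 1 continuous_id).continuousAt
  have hFc : ContinuousAt (fun t : ℝ => F (Function.update x 1 t)) (x 1) := by
    refine ContinuousAt.comp (g := F) ?_ hc
    rw [Function.update_eq_self]
    exact hF.continuousAt (hU.mem_nhds hx)
  have hev : ∀ᶠ t in nhds (x 1), Function.update x 1 t ∈ U := by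
    apply hc
    simpa using hU.mem_nhds hx
  have hev' : ∀ᶠ t in nhdsWithin (x 1) {x 1}ᶜ, F (Function.update x 1 t) = 0 := by
    filter_upwards [nhdsWithin_le_nhds hev, self_mem_nhdsWithin] with t ht htne
    exact h _ ht (by simpa [← hr] using htne)
  have hlim : Filter.Tendsto (fun t : ℝ => F (Function.update x 1 t))
      (nhdsWithin (x 1) {x 1}ᶜ) (nhds 0) :=
    tendsto_const_nhds.congr' (hev'.mono fun _ ht => ht.symm)
  have := tendsto_nhds_unique (hFc.tendsto.mono_left nhdsWithin_le_nhds) hlim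
  simpa using this

theorem isBlockDiagonal_of_forall_ne {U : Set (Fin 4 → ℝ)} (hU : IsOpen U)
    {Z : (Fin 4 → ℝ) → Matrix (Fin 4) (Fin 4) ℝ} (hZ : ContinuousOn Z U) {r₀ : ℝ}
    (h : ∀ x ∈ U, x 1 ≠ r₀ → IsBlockDiagonal (Z x)) : ∀ x ∈ U, IsBlockDiagonal (Z x) := by
  have hc : ∀ i j, ContinuousOn (fun x => Z x i j) U := fun i j =>
    continuousOn_pi.mp (continuousOn_pi.mp hZ i) j
  intro x hx
  refine ⟨?_, ?_, ?_, ?_, ?_, ?_, ?_, ?_⟩ <;>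
    refine eq_zero_of_forall_ne hU (hc _ _) (r₀ := r₀) ?_ x hx <;>
    intro y hy hne <;> obtain ⟨h1, h2, h3, h4, h5, h6, h7, h8⟩ := h y hy hne <;> assumption

theorem exists_forall_ne {M e : ℝ} (hMe : ¬(M = 0 ∧ e = 0)) :
    ∃ r₀ : ℝ, ∀ r, r ≠ r₀ → M * r - e ^ 2 ≠ 0 := by
  -- For `M = 0` the quotient is the default value `0`; then `e ≠ 0`, and no radius at all is
  -- exceptional.
  refine ⟨e ^ 2 / M, fun r hr h => ?_⟩
  by_cases hM : M = 0
  · exact hMe ⟨hM, by simpa [hM] using h⟩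
  · exact hr (by field_simp; linarith)

/-- Away from the constant curvature case the sectional curvatures in the coordinate planes are
not all equal. -/
theorem coeff_ne {M e r : ℝ} (Λ : ℝ) (hr : r ≠ 0) (hMe : ¬(M = 0 ∧ e = 0)) :
    2 * M / r ^ 3 - 3 * e ^ 2 / r ^ 4 + Λ ≠ -M / r ^ 3 + e ^ 2 / r ^ 4 + Λ ∨
      2 * M / r ^ 3 - e ^ 2 / r ^ 4 + Λ ≠ -M / r ^ 3 + e ^ 2 / r ^ 4 + Λ := by
  by_contra! h
  obtain ⟨h1, h2⟩ := h
  field_simp at h1 h2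
  have he : e ^ 2 = 0 := by linarith
  have hM : M * r = 0 := by linarith
  exact hMe ⟨(mul_eq_zero.mp hM).resolve_right hr, by simpa using he⟩

variable {M e Λ : ℝ} {x : Fin 4 → ℝ}

theorem isCompatible_riemann_iff (hx : x ∈ domain M e Λ) (hMe : ¬(M = 0 ∧ e = 0))
    {Z : Matrix (Fin 4) (Fin 4) ℝ} (hZ : Z.IsSymm) :
    IsCompatible (metric M e Λ) x (riemann (metric M e Λ) x) Z ↔ IsBlockDiagonal Z := by
  rw [riemann_metric_explicit hx]
  exact isCompatible_blockCurvature_iff_isBlockDiagonal (metric_eq M e Λ x)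
    (diagEntry_ne_zero hx) (coeff_ne Λ hx.1.ne' hMe) hZ

theorem isCompatible_projective_iff (hx : x ∈ domain M e Λ) (hMe : ¬(M = 0 ∧ e = 0))
    {Z : Matrix (Fin 4) (Fin 4) ℝ} (hZ : Z.IsSymm) :
    IsCompatible (metric M e Λ) x (projectiveSkewLast (metric M e Λ) x) Z
      ↔ IsBlockDiagonal Z := by
  rw [isCompatible_projectiveSkewLast_iff (metric_eq M e Λ x) (diagEntry_ne_zero hx)
    (riemann_metric_explicit hx) hZ, isCompatible_riemann_iff hx hMe hZ]

theorem isCompatible_concircular_iff (hx : x ∈ domain M e Λ) (hMe : ¬(M = 0 ∧ e = 0))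
    {Z : Matrix (Fin 4) (Fin 4) ℝ} (hZ : Z.IsSymm) :
    IsCompatible (metric M e Λ) x (concircular (metric M e Λ) x) Z ↔ IsBlockDiagonal Z := by
  rw [concircular_eq (metric_eq M e Λ x) (diagEntry_ne_zero hx) (riemann_metric_explicit hx)]
  refine isCompatible_blockCurvature_iff_isBlockDiagonal (metric_eq M e Λ x)
    (diagEntry_ne_zero hx) ?_ hZ
  -- Passing from `R` to `W` shifts all three coefficients by the same amount, so their differences
  -- are unchanged.
  simpa only [ne_eq, sub_left_inj] using coeff_ne Λ hx.1.ne' hMe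

theorem isCompatible_conformal_of_isBlockDiagonal (hx : x ∈ domain M e Λ)
    {Z : Matrix (Fin 4) (Fin 4) ℝ} (hZ : Z.IsSymm) (h : IsBlockDiagonal Z) :
    IsCompatible (metric M e Λ) x (conformal (metric M e Λ) x) Z := by
  rw [conformal_eq (metric_eq M e Λ x) (diagEntry_ne_zero hx) (riemann_metric_explicit hx)]
  exact isCompatible_of_isBlockDiagonal (metric_eq M e Λ x) (diagEntry_ne_zero hx) _ _ _ hZ h

theorem isCompatible_conharmonic_of_isBlockDiagonal (hx : x ∈ domain M e Λ)
    {Z : Matrix (Fin 4) (Fin 4) ℝ} (hZ : Z.IsSymm) (h : IsBlockDiagonal Z) :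
    IsCompatible (metric M e Λ) x (conharmonic (metric M e Λ) x) Z := by
  rw [conharmonic_eq (metric_eq M e Λ x) (diagEntry_ne_zero hx) (riemann_metric_explicit hx)]
  exact isCompatible_of_isBlockDiagonal (metric_eq M e Λ x) (diagEntry_ne_zero hx) _ _ _ hZ h

/-- The first two coefficients of `C` differ by `(a - 2b + c)/2 = 3(Mr - e²)/r⁴`; the same
difference occurs for `K`. -/
theorem isCompatible_conformal_iff (hx : x ∈ domain M e Λ) (hMe : M * x 1 - e ^ 2 ≠ 0)
    {Z : Matrix (Fin 4) (Fin 4) ℝ} (hZ : Z.IsSymm) :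
    IsCompatible (metric M e Λ) x (conformal (metric M e Λ) x) Z ↔ IsBlockDiagonal Z := by
  have hr := hx.1.ne'
  rw [conformal_eq (metric_eq M e Λ x) (diagEntry_ne_zero hx) (riemann_metric_explicit hx)]
  refine isCompatible_blockCurvature_iff_isBlockDiagonal (metric_eq M e Λ x)
    (diagEntry_ne_zero hx) (Or.inl fun h => hMe ?_) hZ
  field_simp at h
  linarith

theorem isCompatible_conharmonic_iff (hx : x ∈ domain M e Λ) (hMe : M * x 1 - e ^ 2 ≠ 0)
    {Z : Matrix (Fin 4) (Fin 4) ℝ} (hZ : Z.IsSymm) :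
    IsCompatible (metric M e Λ) x (conharmonic (metric M e Λ) x) Z ↔ IsBlockDiagonal Z := by
  have hr := hx.1.ne'
  rw [conharmonic_eq (metric_eq M e Λ x) (diagEntry_ne_zero hx) (riemann_metric_explicit hx)]
  refine isCompatible_blockCurvature_iff_isBlockDiagonal (metric_eq M e Λ x)
    (diagEntry_ne_zero hx) (Or.inl fun h => hMe ?_) hZ
  field_simp at h
  linarith

end RNdS

/-! ### Assembly of the theorem -/

open ChartGeometry in
open RNdS in
theorem mainTheorem1 (M e Λ : ℝ) :
    -- pointwise curvature identities on the whole coordinate domain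
    (∀ x ∈ RNdS.domain M e Λ,
      let g : Metric 4 := RNdS.metric M e Λ
      let r : ℝ := x 1
      let G : Tensor 4 2 := metricTensor g x
      let R : Tensor 4 4 := riemann g x
      let Ric : Tensor 4 2 := ricci g x
      let C : Tensor 4 4 := conformal g x
      let P : Tensor 4 4 := projective g x
      let W : Tensor 4 4 := concircular g x
      let K : Tensor 4 4 := conharmonic g x
      let LR : ℝ := -((e ^ 2 - M * r + Λ * r ^ 4) / r ^ 4)
      let LC : ℝ := -((e ^ 2 - M * r) / r ^ 4)
      let LK : ℝ := -((e ^ 2 - M * r - 2 * Λ * r ^ 4) / r ^ 4)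
      -- `N` is the numerator of the coefficient of `R·R - Q(Ric,R)`
      let N : ℝ := 2 * e ^ 4 - 6 * e ^ 2 * M * r + 3 * M ^ 2 * r ^ 2
        - 6 * Λ * e ^ 2 * r ^ 4 + 6 * M * Λ * r ^ 5
      -- pseudosymmetry with respect to `R`
      (curvAction g x R R = LR • tachibana G R ∧
        curvAction g x R C = LR • tachibana G C ∧
        curvAction g x R P = LR • tachibana G P ∧
        curvAction g x R W = LR • tachibana G W ∧
        curvAction g x R K = LR • tachibana G K) ∧
      -- pseudosymmetry with respect to `C`
      (curvAction g x C R = LC • tachibana G R ∧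
        curvAction g x C C = LC • tachibana G C ∧
        curvAction g x C P = LC • tachibana G P ∧
        curvAction g x C W = LC • tachibana G W ∧
        curvAction g x C K = LC • tachibana G K) ∧
      -- Ricci pseudosymmetry
      (curvAction g x R Ric = LR • tachibana G Ric ∧
        curvAction g x C Ric = LC • tachibana G Ric ∧
        curvAction g x P Ric = LR • tachibana G Ric ∧
        curvAction g x W Ric = LC • tachibana G Ric ∧
        curvAction g x K Ric = LK • tachibana G Ric) ∧
      -- pseudosymmetry with respect to `W`
      (curvAction g x W R = LC • tachibana G R ∧
        curvAction g x W C = LC • tachibana G C ∧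
        curvAction g x W P = LC • tachibana G P ∧
        curvAction g x W W = LC • tachibana G W ∧
        curvAction g x W K = LC • tachibana G K) ∧
      -- pseudosymmetry with respect to `K`
      (curvAction g x K R = LK • tachibana G R ∧
        curvAction g x K C = LK • tachibana G C ∧
        curvAction g x K P = LK • tachibana G P ∧
        curvAction g x K W = LK • tachibana G W ∧
        curvAction g x K K = LK • tachibana G K) ∧
      -- `R·R - Q(Ric,R) = L₁ Q(g,C)`
      (M * r - e ^ 2 ≠ 0 →
        curvAction g x R R - tachibana Ric R
          = (N / (3 * r ^ 4 * (M * r - e ^ 2))) • tachibana G C) ∧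
      -- `C·R - R·C` as a linear combination of Tachibana tensors, in two ways
      curvAction g x C R - curvAction g x R C = (4 * Λ) • tachibana G C + tachibana Ric C ∧
      (N ≠ 0 →
        curvAction g x C R - curvAction g x R C
          = ((M * r - e ^ 2) / r ^ 4 * (1 - 3 * (Λ * r ^ 4 - M * r + e ^ 2) ^ 2 / N)) •
              tachibana G R
            - (3 * (M * r - e ^ 2) * (Λ * r ^ 4 - M * r + e ^ 2) / N) • tachibana Ric R) ∧
      -- 2-quasi-Einstein
      (e ≠ 0 →
        (Matrix.of fun i j : Fin 4 =>
          Ric ![i, j] - (-((3 * Λ * r ^ 4 - e ^ 2) / r ^ 4)) * g x i j).rank = 2) ∧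
      -- Ein(2)
      ricciSq g x + (6 * Λ) • Ric + ((9 * Λ ^ 2 * r ^ 8 - e ^ 4) / r ^ 8) • G = 0 ∧
      -- compatible tensors at a point
      (¬(M = 0 ∧ e = 0) → ∀ Z : Matrix (Fin 4) (Fin 4) ℝ, Z.IsSymm →
        (IsCompatible g x R Z ↔ RNdS.IsBlockDiagonal Z) ∧
        (IsCompatible g x (projectiveSkewLast g x) Z ↔ RNdS.IsBlockDiagonal Z) ∧
        (IsCompatible g x W Z ↔ RNdS.IsBlockDiagonal Z) ∧
        (M * r - e ^ 2 ≠ 0 → (IsCompatible g x C Z ↔ RNdS.IsBlockDiagonal Z)) ∧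
        (M * r - e ^ 2 ≠ 0 → (IsCompatible g x K Z ↔ RNdS.IsBlockDiagonal Z)))) ∧
    -- compatible tensor fields on an open part of the spacetime, including the locus `M r = e²`
    (¬(M = 0 ∧ e = 0) →
      ∀ (U : Set (Fin 4 → ℝ)), IsOpen U → U ⊆ RNdS.domain M e Λ →
      ∀ (Z : (Fin 4 → ℝ) → Matrix (Fin 4) (Fin 4) ℝ), ContinuousOn Z U →
        (∀ x ∈ U, (Z x).IsSymm) →
      ∀ B : (Fin 4 → ℝ) → Tensor 4 4,
        (B = riemann (RNdS.metric M e Λ) ∨ B = conformal (RNdS.metric M e Λ) ∨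
          B = projectiveSkewLast (RNdS.metric M e Λ) ∨ B = concircular (RNdS.metric M e Λ) ∨
          B = conharmonic (RNdS.metric M e Λ)) →
        ((∀ x ∈ U, IsCompatible (RNdS.metric M e Λ) x (B x) (Z x)) ↔
          ∀ x ∈ U, RNdS.IsBlockDiagonal (Z x))) := by
  constructor
  · intro x hx g r G R Ric C P W K LR LC LK N
    have hr : r ≠ 0 := hx.1.ne'
    have hg : g x = Matrix.diagonal (diagEntry M e Λ x) := metric_eq M e Λ x
    have hd := diagEntry_ne_zero hx
    have hR := riemann_metric_explicit hx
    have hRic := ricci_eq_blockForm hg hd hR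
    have hC := conformal_eq hg hd hR
    have hW := concircular_eq hg hd hR
    have hK := conharmonic_eq hg hd hR
    have hG := metricTensor_eq_blockForm hg
    have hP := projective_eq hg
    have iR : IsBlockInvariant (diagEntry M e Λ x) R := by
      simp only [R, g, hR]; exact isBlockInvariant_blockCurvature _ _ _
    have iC : IsBlockInvariant (diagEntry M e Λ x) C := by
      simp only [C, g, hC]; exact isBlockInvariant_blockCurvature _ _ _
    have iW : IsBlockInvariant (diagEntry M e Λ x) W := by
      simp only [W, g, hW]; exact isBlockInvariant_blockCurvature _ _ _
    have iK : IsBlockInvariant (diagEntry M e Λ x) K := by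
      simp only [K, g, hK]; exact isBlockInvariant_blockCurvature _ _ _
    have iRic : IsBlockInvariant (diagEntry M e Λ x) Ric := by
      simp only [Ric, g, hRic]; exact isBlockInvariant_blockForm _ _
    have iP : IsBlockInvariant (diagEntry M e Λ x) P := by
      simp only [P, g, hP, hRic]
      rw [sub_eq_add_neg, ← neg_smul]
      exact iR.add ((isBlockInvariant_skewProduct _ _ _ _).smul _)
    have aR : ∀ {m : ℕ} {Y : Tensor 4 m}, IsBlockInvariant (diagEntry M e Λ x) Y →
        curvAction g x R Y = LR • tachibana G Y := fun hY => by
      simp only [R, G, g, hR, hG, curvAction_blockCurvature hg hd _ _ _ hY, LR]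
      congr 1
      simp only [r] at hr ⊢
      field_simp
      ring
    have aC : ∀ {m : ℕ} {Y : Tensor 4 m}, IsBlockInvariant (diagEntry M e Λ x) Y →
        curvAction g x C Y = LC • tachibana G Y := fun hY => by
      simp only [C, G, g, hC, hG, curvAction_blockCurvature hg hd _ _ _ hY, LC]
      congr 1
      simp only [r] at hr ⊢
      field_simp
      ring
    have aW : ∀ {m : ℕ} {Y : Tensor 4 m}, IsBlockInvariant (diagEntry M e Λ x) Y →
        curvAction g x W Y = LC • tachibana G Y := fun hY => by
      simp only [W, G, g, hW, hG, curvAction_blockCurvature hg hd _ _ _ hY, LC]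
      congr 1
      simp only [r] at hr ⊢
      field_simp
      ring
    have aK : ∀ {m : ℕ} {Y : Tensor 4 m}, IsBlockInvariant (diagEntry M e Λ x) Y →
        curvAction g x K Y = LK • tachibana G Y := fun hY => by
      simp only [K, G, g, hK, hG, curvAction_blockCurvature hg hd _ _ _ hY, LK]
      congr 1
      simp only [r] at hr ⊢
      field_simp
      ring
    have aP : curvAction g x P Ric = LR • tachibana G Ric := by
      -- The correction in `P` contributes a multiple of `Q(Ric,Ric)`, so `P` acts on `Ric` exactly
      -- as `R` does.
      have hself : tachibana Ric Ric = 0 := by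
        simp only [Ric, g, hRic]
        exact tachibana_self (blockForm_symm _ _)
      simp only [P]
      rw [hP, curvAction_sub_smul, curvAction_skewProduct hg hd]
      change curvAction g x R Ric - (1 / 3 : ℝ) • tachibana Ric Ric = _
      rw [hself, smul_zero, sub_zero, aR iRic]
    refine ⟨⟨aR iR, aR iC, aR iP, aR iW, aR iK⟩, ⟨aC iR, aC iC, aC iP, aC iW, aC iK⟩,
      ⟨aR iRic, aC iRic, aP, aW iRic, aK iRic⟩, ⟨aW iR, aW iC, aW iP, aW iW, aW iK⟩,
      ⟨aK iR, aK iC, aK iP, aK iW, aK iK⟩, ?_, ?_, ?_, ?_, ?_, ?_⟩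
    · intro hMr
      rw [aR iR]
      simp only [R, C, G, Ric, g, hR, hC, hG, hRic]
      -- Both sides become combinations of the same two tensors, to be compared coefficientwise. The
      -- pattern `-_` selects the Ricci form, and `1 1` the metric.
      rw [tachibana_blockForm_blockCurvature 1 1, tachibana_blockForm_blockCurvature (-_),
        tachibana_blockForm_blockCurvature 1 1]
      simp only [LR, N, r] at hr hMr ⊢
      match_scalars <;> field_simp <;> ring
    · rw [aC iR, aR iC]
      simp only [R, C, G, Ric, g, hR, hC, hG, hRic]
      rw [tachibana_blockForm_blockCurvature 1 1, tachibana_blockForm_blockCurvature 1 1,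
        tachibana_blockForm_blockCurvature (-_)]
      simp only [LR, LC, r] at hr ⊢
      match_scalars <;> field_simp <;> ring
    · intro hN
      rw [aC iR, aR iC]
      simp only [R, C, G, Ric, g, hR, hC, hG, hRic]
      rw [tachibana_blockForm_blockCurvature 1 1, tachibana_blockForm_blockCurvature 1 1,
        tachibana_blockForm_blockCurvature (-_)]
      simp only [LR, LC, r] at hr ⊢
      have hNdef : N = 2 * e ^ 4 - 6 * e ^ 2 * M * x 1 + 3 * M ^ 2 * x 1 ^ 2
        - 6 * Λ * e ^ 2 * x 1 ^ 4 + 6 * M * Λ * x 1 ^ 5 := rfl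
      -- `N` stays an opaque nonzero denominator while fractions are cleared, and is expanded only
      -- afterwards.
      clear_value N
      match_scalars <;> field_simp <;> rw [hNdef] <;> ring
    · intro he
      -- `Ric` has weights `-3Λ + e²/r⁴` on `h` and `-3Λ - e²/r⁴` on `k`. The chosen `L` is the
      -- first, so only `k` survives, with the difference of the weights as its factor.
      have hq : -(2 * e ^ 2 / r ^ 4) ≠ 0 := by
        simp [he, hr]
      refine Eq.trans ?_ (rank_blockForm hd hq)
      congr 1
      ext i j
      have e0 : ∀ i, blockWeight 1 1 i = 1 := fun i => by fin_cases i <;> rfl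
      have hgij : g x i j = blockForm (diagEntry M e Λ x) 1 1 ![i, j] := by
        rw [hg, blockForm_apply, e0, one_mul]
      simp only [Matrix.of_apply, hgij, Ric, g, hRic, blockForm_apply, ← mul_assoc, ← sub_mul]
      congr 1
      simp only [r] at hr ⊢
      fin_cases i <;> simp [blockWeight] <;> field_simp <;> ring
    · rw [ricciSq_eq hg hd hRic]
      simp only [G, Ric, g, hRic, hG]
      -- In the basis `h, k` the claim says that both Ricci weights are roots of one quadratic, with
      -- sum `-6Λ` and product `9Λ² - e⁴/r⁸`.
      rw [blockForm_eq (_ ^ 2), blockForm_eq (-_), blockForm_eq 1 1]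
      simp only [r] at hr ⊢
      match_scalars <;> field_simp <;> ring
    · exact fun hMe Z hZ => ⟨isCompatible_riemann_iff hx hMe hZ,
        isCompatible_projective_iff hx hMe hZ, isCompatible_concircular_iff hx hMe hZ,
        fun h => isCompatible_conformal_iff hx h hZ,
        fun h => isCompatible_conharmonic_iff hx h hZ⟩
  · intro hMe U hU hUd Z hZc hZs B hB
    -- Needed only for `C` and `K`: off the level `r = r₀` the pointwise criterion applies, and
    -- continuity of `Z` extends the block form across it.
    obtain ⟨r₀, hr₀⟩ := exists_forall_ne hMe
    rcases hB with rfl | rfl | rfl | rfl | rfl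
    · exact forall₂_congr fun x hx => isCompatible_riemann_iff (hUd hx) hMe (hZs x hx)
    · exact ⟨fun h => isBlockDiagonal_of_forall_ne hU hZc fun x hx hne =>
        (isCompatible_conformal_iff (hUd hx) (hr₀ _ hne) (hZs x hx)).mp (h x hx),
        fun h x hx => isCompatible_conformal_of_isBlockDiagonal (hUd hx) (hZs x hx) (h x hx)⟩
    · exact forall₂_congr fun x hx => isCompatible_projective_iff (hUd hx) hMe (hZs x hx)
    · exact forall₂_congr fun x hx => isCompatible_concircular_iff (hUd hx) hMe (hZs x hx)
    · exact ⟨fun h => isBlockDiagonal_of_forall_ne hU hZc fun x hx hne =>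
        (isCompatible_conharmonic_iff (hUd hx) (hr₀ _ hne) (hZs x hx)).mp (h x hx),
        fun h x hx => isCompatible_conharmonic_of_isBlockDiagonal (hUd hx) (hZs x hx) (h x hx)⟩
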